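/- Let $\lambda>0$, $\mu>0$ and $0<\nu\le 1$, and let $\frac{\mathrm d^\alpha}{\mathrm dt^\alpha}$ denote the Caputo derivative of order $\alpha>0$ with base point $0$: for $n=\lceil\alpha\rceil$, it is $f^{(n)}(t)$ if $\alpha=n$, and $\frac{1}{\Gamma(n-\alpha)}\int_0^t \frac{f^{(n)}(s)}{(t-s)^{\alpha-n+1}}\,\mathrm ds$ if $\alpha<n$ (where $f$ is $C^{n-1}$ on $[0,\infty)$, $f^{(n-1)}$ is locally absolutely continuous there, and the integral converges absolutely for every $t>0$). A *fractional linear birth–death process* of order $\nu$ with rates $\lambda,\mu$ is an $\mathbb N_0$-valued process $N_\nu(t)$, $t\ge 0$, whose state probabilities $p_k(t)=\Pr\{N_\nu(t)=k\}$, $k\ge 0$, satisfy $p_k(0)=\delta_{k,1}$ and $$\frac{\mathrm d^\nu p_k(t)}{\mathrm dt^\nu}=-(\lambda+\mu)k\,p_k(t)+\lambda(k-1)p_{k-1}(t)+\mu(k+1)p_{k+1}(t),\qquad k\ge 1,\ t>0 .$$ Let $N(t)$, $t\ge 0$, be the classical linear birth–death process with birth rates $\lambda k$, death rates $\mu k$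 and $N(0)=1$, that is, the right-continuous time-homogeneous Markov chain whose transition probabilities satisfy, from each initial state, the above system with $\nu=1$. Let $T_{2\nu}(t)\ge 0$, $t\ge 0$, be random variables on the same probability space such that each $T_{2\nu}(t)$ is independent of the process $N$ and has as its law the folded solution (the image under $x\mapsto|x|$) of the fractional diffusion equation $$\frac{\partial^{2\nu}q}{\partial t^{2\nu}}=\frac{\partial^2 q}{\partial x^2},\qquad x\in\mathbb R,\ t>0,$$ with $q(x,0)=\delta(x)$ and, if $\tfrac12<\nu\le 1$, also $q_t(x,0)=0$. Here $q(\cdot,t)$, $t\ge0$, is a family of probability measures on $\mathbb R$, and the equation and the initial conditions hold in the sense of distributions in $x$: for every $\varphi\in C_c^\infty(\mathbb R)$, the function $F_\varphi(t)=\int\varphi(x)\,q(\mathrm dx,t)$ satisfies $\frac{\mathrm d^{2\nu}}{\mathrm dt^{2\nu}}F_\varphi(t)=\int\varphi''(x)\,q(\mathrm dx,t)$ for $t>0$, $F_\varphi(0)=\varphi(0)$ and, if $\nu>\frac12$, $F_\varphi'(0)=0$. Then $N(T_{2\nu}(t))$, $t\ge 0$, is a fractional linear birth–death process of order $\nu$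 with rates $\lambda,\mu$, and every fractional linear birth–death process $N_\nu$ of order $\nu$ with rates $\lambda,\mu$ has the same one-dimensional distributions: $$N_\nu(t)\stackrel{d}{=}N(T_{2\nu}(t)),\qquad t\ge 0 .$$ -/

import Mathlib

open MeasureTheory ProbabilityTheory Set
open scoped NNReal

noncomputable section

namespace FracBD

/-- `D` is, on `(0, ∞)`, the Caputo (Dzherbashyan–Caputo) derivative of order `α > 0` of `f`, with
base point `0`. With `n = ⌈α⌉`, the function `f` is `C^(n-1)` on `[0, ∞)`, its derivative of order
`n - 1` is absolutely continuous on every `[0, t]`, and for every `t > 0`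
* if `α = n`, then `D t` is the ordinary derivative `f^(n)(t)`;
* if `α < n`, then `D t = 1 / Γ(n - α) * ∫₀ᵗ f^(n)(s) (t - s)^(n - α - 1) ds`, the integral being
  absolutely convergent. -/
structure HasCaputoDeriv (α : ℝ) (f D : ℝ → ℝ) : Prop where
  contDiffOn : ContDiffOn ℝ ((⌈α⌉₊ - 1 : ℕ) : WithTop ℕ∞) f (Ici 0)
  absolutelyContinuous : ∀ t : ℝ, 0 < t →
    AbsolutelyContinuousOnInterval (iteratedDerivWithin (⌈α⌉₊ - 1) f (Ici 0)) 0 t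
  eq_of_integer : α = ⌈α⌉₊ → ∀ t : ℝ, 0 < t →
    HasDerivAt (iteratedDerivWithin (⌈α⌉₊ - 1) f (Ici 0)) (D t) t
  integrable_of_noninteger : α ≠ ⌈α⌉₊ → ∀ t : ℝ, 0 < t →
    IntervalIntegrable
      (fun s => deriv (iteratedDerivWithin (⌈α⌉₊ - 1) f (Ici 0)) s * (t - s) ^ (⌈α⌉₊ - α - 1))
      volume 0 t
  eq_of_noninteger : α ≠ ⌈α⌉₊ → ∀ t : ℝ, 0 < t →
    D t = 1 / Real.Gamma (⌈α⌉₊ - α) *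
      ∫ s in (0 : ℝ)..t,
        deriv (iteratedDerivWithin (⌈α⌉₊ - 1) f (Ici 0)) s * (t - s) ^ (⌈α⌉₊ - α - 1)

/-- The functions `p k`, `k = 0, 1, 2, …`, on `[0, ∞)` form, at each time, a probability
distribution on `ℕ`, equal at time `0` to the unit mass at `i`, and solve the system
`d^ν p_k / dt^ν = -(λ + μ) k p_k + λ (k - 1) p_{k-1} + μ (k + 1) p_{k+1}`, `k ≥ 1`. -/
structure SolvesBirthDeathSystem (ν birth death : ℝ) (i : ℕ) (p : ℕ → ℝ → ℝ) : Prop where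
  nonneg : ∀ k t, 0 ≤ t → 0 ≤ p k t
  hasSum_one : ∀ t, 0 ≤ t → HasSum (fun k => p k t) 1
  initial : ∀ k, p k 0 = if k = i then 1 else 0
  equation : ∀ k : ℕ, 1 ≤ k → HasCaputoDeriv ν (p k) (fun t =>
    -(birth + death) * k * p k t + birth * ((k : ℝ) - 1) * p (k - 1) t
      + death * ((k : ℝ) + 1) * p (k + 1) t)

/-- The state probabilities `t ↦ Pr {X t = k}` of an `ℕ`-valued process (only `t ≥ 0` matters). -/
def stateProb {Ω : Type*} [MeasurableSpace Ω] (P : Measure Ω) (X : ℝ≥0 → Ω → ℕ) (k : ℕ) (t : ℝ) :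
    ℝ :=
  P.real {ω | X t.toNNReal ω = k}

/-- A fractional linear birth–death process of order `ν` with one progenitor: a process whose state
probabilities solve the fractional system and which starts at `1`. As in the definition of the
process, nothing is required of its finite-dimensional distributions. -/
structure IsFractionalLinearBirthDeath {Ω : Type*} [MeasurableSpace Ω] (ν birth death : ℝ)
    (P : Measure Ω) (X : ℝ≥0 → Ω → ℕ) : Prop where
  measurable : ∀ t, Measurable (X t)
  stateProb_solves : SolvesBirthDeathSystem ν birth death 1 (stateProb P X)

/-- The classical linear birth–death process with one progenitor: a time-homogeneous Markov chain
on `ℕ` with right-continuous paths, started at `1`, whose transition probabilities `p i j t` solve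
Kolmogorov's forward equations with birth rates `λ k` and death rates `μ k`. -/
structure IsClassicalLinearBirthDeath {Ω : Type*} [MeasurableSpace Ω] (birth death : ℝ)
    (P : Measure Ω) (N : ℝ≥0 → Ω → ℕ) : Prop where
  measurable : ∀ t, Measurable (N t)
  right_continuous : ∀ ω s, ContinuousWithinAt (fun r => N r ω) (Ici s) s
  initial : ∀ᵐ ω ∂P, N 0 ω = 1
  markov : ∃ p : ℕ → ℕ → ℝ → ℝ,
    (∀ i, SolvesBirthDeathSystem 1 birth death i (p i)) ∧
    ∀ (s t : ℝ≥0) (i j : ℕ) (A : Set Ω),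
      MeasurableSet[⨆ r : Iic s, MeasurableSpace.comap (N r) ⊤] A →
      P.real (A ∩ {ω | N s ω = i} ∩ {ω | N (s + t) ω = j}) =
        P.real (A ∩ {ω | N s ω = i}) * p i j t

/-- The family of probability measures `q t` (to be thought of as `q(x, t) dx`), `t ≥ 0`, is the
fundamental solution of `∂^α q / ∂t^α = ∂² q / ∂x²` on `ℝ`, `0 < α ≤ 2`: the equation holds in the
sense of distributions in `x` (tested against compactly supported smooth `φ`), `q(x, 0) = δ(x)`,
and `q_t(x, 0) = 0` if `α > 1`. The solution has to be a family of measures since it has no density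
for `α = 2`, and the equation has to be weak in `x` since the density has a corner at `x = 0`
for `1 ≠ α < 2`. -/
structure IsFundamentalSolution (α : ℝ) (q : ℝ → Measure ℝ) : Prop where
  isProbabilityMeasure : ∀ t, 0 ≤ t → IsProbabilityMeasure (q t)
  initial : q 0 = Measure.dirac 0
  equation : ∀ φ : ℝ → ℝ, ContDiff ℝ ((⊤ : ℕ∞) : WithTop ℕ∞) φ → HasCompactSupport φ →
    HasCaputoDeriv α (fun t => ∫ x, φ x ∂(q t)) (fun t => ∫ x, iteratedDeriv 2 φ x ∂(q t))
  initial_deriv : 1 < α → ∀ φ : ℝ → ℝ, ContDiff ℝ ((⊤ : ℕ∞) : WithTop ℕ∞) φ → HasCompactSupport φ →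
    HasDerivWithinAt (fun t => ∫ x, φ x ∂(q t)) 0 (Ici 0) 0

/-- The folding of a measure on `ℝ` onto the half-line: the image under `x ↦ |x|`. A density `q`
becomes `q(x) + q(-x)`, `x > 0`. -/
def fold (m : Measure ℝ) : Measure ℝ≥0 :=
  m.map Real.nnabs

end FracBD

end

/-!
Under the Laplace transform in time the diffusion equation, tested against cosines, becomes
algebraic. Its solution shows that the folded law `q t` is `t ^ ν`-self-similar, and that at an
independent exponential time of rate `u` it is the exponential law of rate `u ^ ν`. Averaging a
function `f` over the folded laws therefore turns the transform of `f` at `u ^ ν` into the transform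
of the average at `u`, that is, it turns `f'` into the Caputo derivative of order `ν`: the state
probabilities of the classical process become a solution of the fractional system. For uniqueness,
the Laplace transforms of the differences of two solutions are summable over the states and satisfy
the resolvent equation of the forward system at `u ^ ν > 0`, which has no nonzero summable solution.
-/

noncomputable section

namespace FracBD

open Filter Topology

/-- The Riemann–Liouville fractional integral of order `a` with base point `0`. -/
def fracInt (a : ℝ) (g : ℝ → ℝ) (t : ℝ) : ℝ :=
  1 / Real.Gamma a * ∫ s in (0 : ℝ)..t, g s * (t - s) ^ (a - 1)

theorem fracInt_one (g : ℝ → ℝ) (t : ℝ) : fracInt 1 g t = ∫ s in (0 : ℝ)..t, g s := by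
  simp [fracInt]

theorem fracInt_zero_right (a : ℝ) (g : ℝ → ℝ) : fracInt a g 0 = 0 := by
  simp [fracInt]

theorem fracInt_congr {a t : ℝ} {f g : ℝ → ℝ} (ht : 0 ≤ t) (h : ∀ s, 0 < s → s ≤ t → f s = g s) :
    fracInt a f t = fracInt a g t := by
  unfold fracInt
  congr 1
  refine intervalIntegral.integral_congr_ae (Eventually.of_forall fun s hs => ?_)
  rw [uIoc_of_le ht] at hs
  rw [h s hs.1 hs.2]

theorem fracInt_const {a : ℝ} (ha : 0 < a) (c t : ℝ) :
    fracInt a (fun _ => c) t = c * t ^ a / Real.Gamma (a + 1) := by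
  have h : ∫ s in (0 : ℝ)..t, (t - s) ^ (a - 1) = t ^ a / a := by
    rw [intervalIntegral.integral_comp_sub_left (fun x => x ^ (a - 1)), sub_self, sub_zero,
      integral_rpow (Or.inl (by linarith)), sub_add_cancel, Real.zero_rpow ha.ne', sub_zero]
  have := Real.Gamma_pos_of_pos ha
  rw [fracInt, intervalIntegral.integral_const_mul, h, Real.Gamma_add_one ha.ne']
  field_simp

theorem intervalIntegrable_sub_rpow {a t : ℝ} (ha : 0 < a) :
    IntervalIntegrable (fun s => (t - s) ^ (a - 1)) volume 0 t := by
  have h := (intervalIntegral.intervalIntegrable_rpow' (a := 0) (b := t)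
    (show -1 < a - 1 by linarith)).comp_sub_left t
  simpa using h.symm

theorem norm_mul_sub_rpow_le {a s t x C : ℝ} (hs : s ≤ t) (hx : |x| ≤ C) :
    ‖x * (t - s) ^ (a - 1)‖ ≤ C * (t - s) ^ (a - 1) := by
  have h := Real.rpow_nonneg (sub_nonneg.2 hs) (a - 1)
  rw [norm_mul, Real.norm_eq_abs, Real.norm_of_nonneg h]
  exact mul_le_mul_of_nonneg_right hx h

theorem abs_fracInt_le {a t C : ℝ} {g : ℝ → ℝ} (ha : 0 < a) (ht : 0 ≤ t)
    (hg : ∀ s, 0 < s → s ≤ t → |g s| ≤ C) : |fracInt a g t| ≤ C * t ^ a / Real.Gamma (a + 1) := by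
  have hΓ := one_div_pos.2 (Real.Gamma_pos_of_pos ha)
  rw [← fracInt_const ha, fracInt, fracInt, abs_mul, abs_of_pos hΓ]
  refine mul_le_mul_of_nonneg_left ?_ hΓ.le
  rw [← Real.norm_eq_abs]
  exact intervalIntegral.norm_integral_le_of_norm_le ht
    (Eventually.of_forall fun s hs => norm_mul_sub_rpow_le hs.2 (hg s hs.1 hs.2))
    ((intervalIntegrable_sub_rpow ha).const_mul C)

theorem tendsto_fracInt {a t C : ℝ} {g : ℕ → ℝ → ℝ} {g' : ℝ → ℝ} (ha : 0 < a) (ht : 0 ≤ t)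
    (hm : ∀ n, ContinuousOn (g n) (Ici 0)) (hb : ∀ n s, 0 ≤ s → |g n s| ≤ C)
    (hl : ∀ s, 0 ≤ s → Tendsto (fun n => g n s) atTop (𝓝 (g' s))) :
    Tendsto (fun n => fracInt a (g n) t) atTop (𝓝 (fracInt a g' t)) := by
  refine Tendsto.const_mul _ (intervalIntegral.tendsto_integral_filter_of_dominated_convergence
    (fun s => C * (t - s) ^ (a - 1)) (Eventually.of_forall fun n => ?_)
    (Eventually.of_forall fun n => Eventually.of_forall fun s hs => ?_)
    ((intervalIntegrable_sub_rpow ha).const_mul C) (Eventually.of_forall fun s hs => ?_))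
  all_goals rw [uIoc_of_le ht] at *
  · have hk : Measurable fun s : ℝ => (t - s) ^ (a - 1) := by fun_prop
    exact (((hm n).mono (Ioc_subset_Ioi_self.trans Ioi_subset_Ici_self)).aestronglyMeasurable
      measurableSet_Ioc).mul hk.aestronglyMeasurable
  · exact norm_mul_sub_rpow_le hs.2 (hb n s hs.1.le)
  · exact (hl s hs.1.le).mul_const _

section Semigroup

variable {a b r t : ℝ} {g : ℝ → ℝ}

theorem integral_rpow_mul_sub_rpow {c : ℝ} (ha : 0 < a) (hb : 0 < b) (hc : 0 < c) :
    ∫ x in (0 : ℝ)..c, x ^ (a - 1) * (c - x) ^ (b - 1) = c ^ (a + b - 1) * beta a b := by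
  have h := Complex.betaIntegral_scaled a b hc
  have hcast : ∫ x in (0 : ℝ)..c, (x : ℂ) ^ ((a : ℂ) - 1) * ((c : ℂ) - x) ^ ((b : ℂ) - 1)
      = ((∫ x in (0 : ℝ)..c, x ^ (a - 1) * (c - x) ^ (b - 1) : ℝ) : ℂ) := by
    rw [← intervalIntegral.integral_ofReal]
    refine intervalIntegral.integral_congr fun x hx => ?_
    rw [uIcc_of_le hc.le] at hx
    push_cast
    rw [Complex.ofReal_cpow hx.1, Complex.ofReal_cpow (sub_nonneg.2 hx.2)]
    push_cast
    rfl
  rw [hcast, show ((a : ℂ) + b - 1) = ((a + b - 1 : ℝ) : ℂ) by push_cast; ring,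
    ← Complex.ofReal_cpow hc.le] at h
  simpa only [Complex.ofReal_re, Complex.re_ofReal_mul, beta_eq_betaIntegralReal a b ha hb]
    using congrArg Complex.re h

theorem integral_sub_rpow_mul_sub_rpow (ha : 0 < a) (hb : 0 < b) (h : r < t) :
    ∫ s in r..t, (s - r) ^ (b - 1) * (t - s) ^ (a - 1) = (t - r) ^ (a + b - 1) * beta b a := by
  have hshift := intervalIntegral.integral_comp_sub_right (a := r) (b := t)
    (fun x => x ^ (b - 1) * (t - r - x) ^ (a - 1)) r
  rw [sub_self] at hshift
  rw [add_comm a b, ← integral_rpow_mul_sub_rpow hb ha (sub_pos.2 h), ← hshift]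
  simp only [sub_sub_sub_cancel_right]

theorem intervalIntegrable_sub_rpow_mul_sub_rpow (ha : 0 < a) (hb : 0 < b) (h : r < t) :
    IntervalIntegrable (fun s => (s - r) ^ (b - 1) * (t - s) ^ (a - 1)) volume r t := by
  refine intervalIntegral.intervalIntegrable_of_integral_ne_zero ?_
  rw [integral_sub_rpow_mul_sub_rpow ha hb h]
  exact (mul_pos (Real.rpow_pos_of_pos (sub_pos.2 h) _) (beta_pos hb ha)).ne'

/-- The kernel `(s - r)^(b-1) (t - s)^(a-1)`, `r < s ≤ t`, of the iterated integral `I^a I^b` at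
time `t`, without the Gamma factors. -/
def fracKernel (a b t r s : ℝ) : ℝ :=
  (Ioc r t).indicator (fun s => (s - r) ^ (b - 1) * (t - s) ^ (a - 1)) s

theorem measurable_fracKernel (a b t : ℝ) :
    Measurable fun p : ℝ × ℝ => fracKernel a b t p.1 p.2 := by
  unfold fracKernel
  simp only [indicator_apply, mem_Ioc]
  refine Measurable.ite ?_ (by fun_prop) (by fun_prop)
  exact (measurableSet_lt measurable_fst measurable_snd).inter
    (measurableSet_le measurable_snd measurable_const)

theorem fracKernel_nonneg (a b t r s : ℝ) : 0 ≤ fracKernel a b t r s :=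
  indicator_nonneg (fun _ hs => mul_nonneg (Real.rpow_nonneg (sub_nonneg.2 hs.1.le) _)
    (Real.rpow_nonneg (sub_nonneg.2 hs.2) _)) s

theorem integrableOn_fracKernel (ha : 0 < a) (hb : 0 < b) (h : r < t) :
    IntegrableOn (fracKernel a b t r) (Ioc 0 t) := by
  have hi := intervalIntegrable_sub_rpow_mul_sub_rpow ha hb h
  rw [intervalIntegrable_iff_integrableOn_Ioc_of_le h.le] at hi
  exact (hi.integrable_indicator measurableSet_Ioc).integrableOn

theorem setIntegral_fracKernel (ha : 0 < a) (hb : 0 < b) (hr : 0 ≤ r) (h : r < t) :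
    ∫ s in Ioc 0 t, fracKernel a b t r s = (t - r) ^ (a + b - 1) * beta b a := by
  unfold fracKernel
  rw [setIntegral_indicator measurableSet_Ioc, inter_eq_right.2 (Ioc_subset_Ioc_left hr),
    ← intervalIntegral.integral_of_le h.le, integral_sub_rpow_mul_sub_rpow ha hb h]

theorem ae_restrict_Ioc_mem_Ioo (r t : ℝ) : ∀ᵐ s ∂volume.restrict (Ioc r t), s ∈ Ioo r t := by
  rw [← restrict_Ioo_eq_restrict_Ioc]
  exact ae_restrict_mem measurableSet_Ioo

theorem integrable_mul_fracKernel (ha : 0 < a) (hb : 0 < b) (hab : 1 ≤ a + b)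
    (hg : IntegrableOn g (Ioc 0 t)) :
    Integrable (fun p : ℝ × ℝ => g p.1 * fracKernel a b t p.1 p.2)
      ((volume.restrict (Ioc 0 t)).prod (volume.restrict (Ioc 0 t))) := by
  have hm : AEStronglyMeasurable (fun p : ℝ × ℝ => g p.1 * fracKernel a b t p.1 p.2)
      ((volume.restrict (Ioc 0 t)).prod (volume.restrict (Ioc 0 t))) :=
    hg.aestronglyMeasurable.comp_fst.mul (measurable_fracKernel a b t).aestronglyMeasurable
  refine (integrable_prod_iff hm).2 ⟨?_, Integrable.mono'
    (hg.norm.const_mul (t ^ (a + b - 1) * beta b a)) hm.norm.integral_prod_right' ?_⟩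
  · filter_upwards [ae_restrict_Ioc_mem_Ioo 0 t] with r hr
    exact (integrableOn_fracKernel ha hb hr.2).const_mul _
  · filter_upwards [ae_restrict_Ioc_mem_Ioo 0 t] with r hr
    have hβ := beta_pos hb ha
    have htr := sub_nonneg.2 hr.2.le
    simp only [norm_mul, Real.norm_of_nonneg (fracKernel_nonneg a b t r _)]
    rw [integral_const_mul, setIntegral_fracKernel ha hb hr.1.le hr.2, norm_mul, norm_norm,
      mul_comm, Real.norm_of_nonneg (mul_nonneg (Real.rpow_nonneg htr _) hβ.le)]
    gcongr
    linarith [hr.1]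

theorem setIntegral_mul_fracKernel {s : ℝ} (hs : s ∈ Ioc 0 t) :
    ∫ r in Ioc 0 t, g r * fracKernel a b t r s
      = (∫ r in (0 : ℝ)..s, g r * (s - r) ^ (b - 1)) * (t - s) ^ (a - 1) := by
  have hsub : Ioo 0 s ⊆ Ioc 0 t := Ioo_subset_Ioc_self.trans (Ioc_subset_Ioc_right hs.2)
  rw [← intervalIntegral.integral_mul_const, intervalIntegral.integral_of_le hs.1.le,
    integral_Ioc_eq_integral_Ioo (x := 0) (y := s), ← inter_eq_right.2 hsub,
    ← setIntegral_indicator measurableSet_Ioo]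
  refine setIntegral_congr_fun measurableSet_Ioc fun r hr => ?_
  simp only [indicator_apply, fracKernel, mem_Ioc, mem_Ioo, hr.1, hs.2, and_true, true_and,
    mul_ite, mul_zero, mul_assoc]

theorem fracInt_fracInt (ha : 0 < a) (hb : 0 < b) (hab : 1 ≤ a + b) (ht : 0 ≤ t)
    (hg : IntervalIntegrable g volume 0 t) :
    fracInt a (fracInt b g) t = fracInt (a + b) g t := by
  rw [intervalIntegrable_iff_integrableOn_Ioc_of_le ht] at hg
  have hleft : fracInt a (fracInt b g) t = 1 / Real.Gamma a * (1 / Real.Gamma b *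
      ∫ s in Ioc 0 t, ∫ r in Ioc 0 t, g r * fracKernel a b t r s) := by
    rw [setIntegral_congr_fun measurableSet_Ioc fun s hs => setIntegral_mul_fracKernel hs,
      fracInt, intervalIntegral.integral_of_le ht, ← integral_const_mul (1 / Real.Gamma b)]
    simp only [fracInt, mul_assoc]
  have hright : ∫ r in Ioc 0 t, ∫ s in Ioc 0 t, g r * fracKernel a b t r s
      = beta b a * ∫ r in Ioc 0 t, g r * (t - r) ^ (a + b - 1) := by
    rw [← integral_const_mul]
    refine integral_congr_ae ?_
    filter_upwards [ae_restrict_Ioc_mem_Ioo 0 t] with r hr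
    rw [integral_const_mul, setIntegral_fracKernel ha hb hr.1.le hr.2]
    ring
  rw [hleft, ← integral_integral_swap (integrable_mul_fracKernel ha hb hab hg), hright, fracInt,
    intervalIntegral.integral_of_le ht, beta, add_comm b a]
  field_simp [(Real.Gamma_pos_of_pos ha).ne', (Real.Gamma_pos_of_pos hb).ne']

end Semigroup

/-- The Laplace transform of a function on `(0, ∞)`. -/
def laplace (g : ℝ → ℝ) (u : ℝ) : ℝ :=
  ∫ t in Ioi (0 : ℝ), Real.exp (-(u * t)) * g t

/-- The Laplace integral of `g` at `u` converges absolutely. -/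
def LaplaceIntegrable (g : ℝ → ℝ) (u : ℝ) : Prop :=
  IntegrableOn (fun t => Real.exp (-(u * t)) * g t) (Ioi (0 : ℝ))

section Laplace

variable {f g : ℝ → ℝ} {a c u C : ℝ}

theorem integrableOn_rpow_mul_exp (ha : 0 < a) (hu : 0 < u) :
    IntegrableOn (fun t : ℝ => t ^ (a - 1) * Real.exp (-(u * t))) (Ioi 0) := by
  simpa using integrableOn_rpow_mul_exp_neg_mul_rpow (p := 1) (by linarith) one_pos hu

namespace LaplaceIntegrable

theorem of_le_mul_rpow (ha : 0 < a) (hu : 0 < u)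
    (hm : AEStronglyMeasurable g (volume.restrict (Ioi 0)))
    (hb : ∀ t, 0 < t → |g t| ≤ C * t ^ (a - 1)) : LaplaceIntegrable g u := by
  refine Integrable.mono' ((integrableOn_rpow_mul_exp ha hu).const_mul C)
    (AEStronglyMeasurable.mul (by fun_prop) hm) ?_
  filter_upwards [ae_restrict_mem measurableSet_Ioi] with t ht
  rw [norm_mul, Real.norm_eq_abs, Real.norm_eq_abs, Real.abs_exp, mul_comm, ← mul_assoc]
  exact mul_le_mul_of_nonneg_right (hb t ht) (Real.exp_pos _).le

theorem of_bounded (hu : 0 < u) (hm : AEStronglyMeasurable g (volume.restrict (Ioi 0)))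
    (hb : ∀ t, 0 < t → |g t| ≤ C) : LaplaceIntegrable g u :=
  .of_le_mul_rpow one_pos hu hm (C := C) (by simpa using hb)

theorem of_continuousOn (hu : 0 < u) (hc : ContinuousOn g (Ici 0))
    (hb : ∀ t, 0 ≤ t → |g t| ≤ C) : LaplaceIntegrable g u :=
  .of_bounded hu ((hc.mono Ioi_subset_Ici_self).aestronglyMeasurable measurableSet_Ioi)
    fun t ht => hb t ht.le

theorem const (hu : 0 < u) (c : ℝ) : LaplaceIntegrable (fun _ => c) u :=
  .of_continuousOn hu continuousOn_const fun _ _ => le_rfl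

theorem add (hf : LaplaceIntegrable f u) (hg : LaplaceIntegrable g u) :
    LaplaceIntegrable (fun t => f t + g t) u := by
  simp only [LaplaceIntegrable, mul_add]
  exact Integrable.add hf hg

theorem const_mul (hf : LaplaceIntegrable f u) (c : ℝ) :
    LaplaceIntegrable (fun t => c * f t) u := by
  simp only [LaplaceIntegrable, mul_left_comm _ c]
  exact Integrable.const_mul hf c

end LaplaceIntegrable

theorem laplace_congr (h : ∀ t, 0 < t → f t = g t) (u : ℝ) : laplace f u = laplace g u :=
  setIntegral_congr_fun measurableSet_Ioi fun t ht => by simp only [h t ht]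

theorem laplace_const (hu : 0 < u) (c : ℝ) : laplace (fun _ => c) u = c / u := by
  have h := integral_exp_mul_Ioi (neg_lt_zero.2 hu) 0
  simp only [neg_mul, mul_zero, Real.exp_zero, neg_div_neg_eq] at h
  rw [laplace, integral_mul_const, h, one_div_mul_eq_div]

theorem laplace_add (hf : LaplaceIntegrable f u) (hg : LaplaceIntegrable g u) :
    laplace (fun t => f t + g t) u = laplace f u + laplace g u := by
  simp only [laplace, mul_add, integral_add hf hg]

theorem laplace_const_mul (c : ℝ) (f : ℝ → ℝ) (u : ℝ) :
    laplace (fun t => c * f t) u = c * laplace f u := by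
  simp only [laplace, mul_left_comm _ c, integral_const_mul]

theorem laplace_comp_mul_left (g : ℝ → ℝ) (hc : 0 < c) (u : ℝ) :
    laplace (fun t => g (c * t)) u = c⁻¹ * laplace g (u / c) := by
  have h := integral_comp_mul_left_Ioi (fun t => Real.exp (-(u / c * t)) * g t) 0 hc
  rw [mul_zero, smul_eq_mul] at h
  rw [laplace, laplace, ← h]
  simp only [← mul_assoc, div_mul_cancel₀ u hc.ne']

theorem exp_mul_fracInt (a : ℝ) (g : ℝ → ℝ) (u t : ℝ) :
    Real.exp (-(u * t)) * fracInt a g t = 1 / Real.Gamma a *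
      ∫ s in (0 : ℝ)..t, ContinuousLinearMap.mul ℝ ℝ (Real.exp (-(u * s)) * g s)
        ((t - s) ^ (a - 1) * Real.exp (-(u * (t - s)))) := by
  rw [fracInt, mul_left_comm, ← intervalIntegral.integral_const_mul]
  congr 1
  refine intervalIntegral.integral_congr fun s _ => ?_
  simp only [ContinuousLinearMap.mul_apply']
  rw [show -(u * t) = -(u * s) + -(u * (t - s)) by ring, Real.exp_add]
  ring

theorem LaplaceIntegrable.fracInt (ha : 0 < a) (hu : 0 < u) (hg : LaplaceIntegrable g u) :
    LaplaceIntegrable (fracInt a g) u := by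
  have h := (integrable_posConvolution hg (integrableOn_rpow_mul_exp ha hu)
    (ContinuousLinearMap.mul ℝ ℝ)).integrableOn (s := Ioi 0)
  simp only [LaplaceIntegrable, exp_mul_fracInt]
  refine (IntegrableOn.congr_fun h (fun t ht => ?_) measurableSet_Ioi).const_mul _
  simp only [posConvolution, indicator_of_mem ht]

theorem laplace_fracInt (ha : 0 < a) (hu : 0 < u) (hg : LaplaceIntegrable g u) :
    laplace (fracInt a g) u = u ^ (-a) * laplace g u := by
  have h := integral_posConvolution hg (integrableOn_rpow_mul_exp ha hu)
    (ContinuousLinearMap.mul ℝ ℝ)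
  rw [laplace, laplace]
  simp only [exp_mul_fracInt]
  rw [integral_const_mul, h, ContinuousLinearMap.mul_apply',
    Real.integral_rpow_mul_exp_neg_mul_Ioi ha hu, one_div u, Real.inv_rpow hu.le,
    Real.rpow_neg hu.le]
  field_simp [(Real.Gamma_pos_of_pos ha).ne']

theorem laplace_eq_of_eq_const_add_fracInt (ha : 0 < a) (hu : 0 < u) (hg : LaplaceIntegrable g u)
    (h : ∀ t, 0 < t → f t = c + fracInt a g t) : laplace f u = c / u + u ^ (-a) * laplace g u := by
  rw [laplace_congr h, laplace_add (.const hu c) (hg.fracInt ha hu), laplace_const hu,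
    laplace_fracInt ha hu hg]

end Laplace

section Uniqueness

open scoped BoundedContinuousFunction

/-- The bounded continuous function `x ↦ exp (-x)` on `[0, ∞)`, whose powers separate finite
measures on `[0, ∞)`. -/
def expNegBCF : ℝ≥0 →ᵇ ℝ :=
  .ofNormedAddCommGroup (fun x => Real.exp (-x)) (by fun_prop) 1 fun x => by simp

theorem integral_aeval_expNegBCF_eq {μ ν : Measure ℝ≥0} [IsFiniteMeasure μ] [IsFiniteMeasure ν]
    (h : ∀ n : ℕ, ∫ x, Real.exp (-(n * x)) ∂μ = ∫ x, Real.exp (-(n * x)) ∂ν)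
    (p : Polynomial ℝ) :
    ∫ x, Polynomial.aeval expNegBCF p x ∂μ = ∫ x, Polynomial.aeval expNegBCF p x ∂ν := by
  induction p using Polynomial.induction_on' with
  | add p r hp hr =>
    simp only [map_add, BoundedContinuousFunction.add_apply]
    rw [integral_add (BoundedContinuousFunction.integrable _ _)
        (BoundedContinuousFunction.integrable _ _), hp, hr,
      integral_add (BoundedContinuousFunction.integrable _ _)
        (BoundedContinuousFunction.integrable _ _)]
  | monomial n c =>
    have hpow : ∀ x : ℝ≥0, Polynomial.aeval expNegBCF (Polynomial.monomial n c) x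
        = c * Real.exp (-(n * x)) := fun x => by
      simp [Polynomial.aeval_monomial, expNegBCF, ← Real.exp_nat_mul,
        Algebra.algebraMap_eq_smul_one]
    simp only [hpow, integral_const_mul, h]

theorem measure_nnreal_ext_of_integral_exp_eq {μ ν : Measure ℝ≥0} [IsFiniteMeasure μ]
    [IsFiniteMeasure ν]
    (h : ∀ n : ℕ, ∫ x, Real.exp (-(n * x)) ∂μ = ∫ x, Real.exp (-(n * x)) ∂ν) : μ = ν := by
  let A : StarSubalgebra ℝ (ℝ≥0 →ᵇ ℝ) :=
    { (Polynomial.aeval (R := ℝ) expNegBCF).range with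
      star_mem' := fun {f} hf => by
        rwa [show star f = f from BoundedContinuousFunction.ext fun _ => rfl] }
  refine ext_of_forall_mem_subalgebra_integral_eq_of_polish (A := A) (fun x y hxy => ?_) ?_
  · refine ⟨expNegBCF, ⟨_, ⟨expNegBCF, ⟨Polynomial.X, Polynomial.aeval_X _⟩, rfl⟩, rfl⟩, ?_⟩
    simpa [expNegBCF] using hxy
  · rintro _ ⟨p, rfl⟩
    exact integral_aeval_expNegBCF_eq h p

theorem measure_real_ext_of_integral_exp_eq {μ ν : Measure ℝ} [IsFiniteMeasure μ]
    [IsFiniteMeasure ν] (hμ : ∀ᵐ x ∂μ, 0 ≤ x) (hν : ∀ᵐ x ∂ν, 0 ≤ x)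
    (h : ∀ n : ℕ, ∫ x, Real.exp (-(n * x)) ∂μ = ∫ x, Real.exp (-(n * x)) ∂ν) : μ = ν := by
  have hfold : ∀ m : Measure ℝ, (∀ᵐ x ∂m, 0 ≤ x) → ∀ n : ℕ,
      ∫ x : ℝ≥0, Real.exp (-(n * x)) ∂(m.map Real.toNNReal) = ∫ x, Real.exp (-(n * x)) ∂m := by
    intro m hm n
    rw [integral_map (by fun_prop) (by fun_prop)]
    refine integral_congr_ae ?_
    filter_upwards [hm] with x hx
    rw [Real.coe_toNNReal x hx]
  have hunfold : ∀ m : Measure ℝ, (∀ᵐ x ∂m, 0 ≤ x) →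
      (m.map Real.toNNReal).map NNReal.toReal = m := by
    intro m hm
    rw [Measure.map_map (by fun_prop) (by fun_prop)]
    refine (Measure.map_congr ?_).trans Measure.map_id
    filter_upwards [hm] with x hx
    exact Real.coe_toNNReal x hx
  rw [← hunfold μ hμ, ← hunfold ν hν, measure_nnreal_ext_of_integral_exp_eq
    (fun n => (hfold μ hμ n).trans ((h n).trans (hfold ν hν n).symm))]

variable {f g : ℝ → ℝ}

/-- The finite measure on `(0, ∞)` with density `e^{-t} f(t)`, for `f ≥ 0`; its Laplace transform is
that of `f`, shifted by one. -/
def expWeighted (f : ℝ → ℝ) : Measure ℝ :=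
  (volume.restrict (Ioi 0)).withDensity fun t => ENNReal.ofReal (Real.exp (-t) * f t)

theorem LaplaceIntegrable.integrableOn_exp_neg_mul (hf : LaplaceIntegrable f 1) :
    IntegrableOn (fun t => Real.exp (-t) * f t) (Ioi 0) := by
  simpa only [LaplaceIntegrable, one_mul] using hf

theorem isFiniteMeasure_expWeighted (hf : LaplaceIntegrable f 1) :
    IsFiniteMeasure (expWeighted f) :=
  isFiniteMeasure_withDensity_ofReal hf.integrableOn_exp_neg_mul.2

theorem ae_nonneg_expWeighted (f : ℝ → ℝ) : ∀ᵐ x ∂expWeighted f, 0 ≤ x := by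
  refine (withDensity_absolutelyContinuous _ _).ae_le ?_
  filter_upwards [ae_restrict_mem measurableSet_Ioi] with x hx using hx.le

theorem integral_exp_expWeighted (hf0 : ∀ t, 0 < t → 0 ≤ f t) (hf : LaplaceIntegrable f 1) (u : ℝ) :
    ∫ x, Real.exp (-(u * x)) ∂expWeighted f = laplace f (u + 1) := by
  rw [expWeighted, integral_withDensity_eq_integral_toReal_smul₀
    hf.integrableOn_exp_neg_mul.aemeasurable.ennreal_ofReal
    (Eventually.of_forall fun _ => ENNReal.ofReal_lt_top), laplace]
  refine setIntegral_congr_fun measurableSet_Ioi fun t ht => ?_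
  simp only [smul_eq_mul]
  rw [ENNReal.toReal_ofReal (mul_nonneg (Real.exp_pos _).le (hf0 t ht)),
    show -((u + 1) * t) = -(u * t) + -t by ring, Real.exp_add]
  ring

theorem ae_eq_of_laplace_eq_of_nonneg (hf0 : ∀ t, 0 < t → 0 ≤ f t) (hg0 : ∀ t, 0 < t → 0 ≤ g t)
    (hf : LaplaceIntegrable f 1) (hg : LaplaceIntegrable g 1)
    (h : ∀ u, 0 < u → laplace f u = laplace g u) : f =ᵐ[volume.restrict (Ioi 0)] g := by
  have := isFiniteMeasure_expWeighted hf
  have := isFiniteMeasure_expWeighted hg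
  have hP : expWeighted f = expWeighted g :=
    measure_real_ext_of_integral_exp_eq (ae_nonneg_expWeighted f) (ae_nonneg_expWeighted g)
      fun n => by
        rw [integral_exp_expWeighted hf0 hf, integral_exp_expWeighted hg0 hg, h _ (by positivity)]
  filter_upwards [(withDensity_eq_iff_of_sigmaFinite
    hf.integrableOn_exp_neg_mul.aemeasurable.ennreal_ofReal
    hg.integrableOn_exp_neg_mul.aemeasurable.ennreal_ofReal).1 hP,
    ae_restrict_mem measurableSet_Ioi] with t hfg ht
  rw [ENNReal.ofReal_eq_ofReal_iff (mul_nonneg (Real.exp_pos _).le (hf0 t ht))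
    (mul_nonneg (Real.exp_pos _).le (hg0 t ht))] at hfg
  exact mul_left_cancel₀ (Real.exp_pos _).ne' hfg

theorem eqOn_of_laplace_eq {C D : ℝ} (hf : ContinuousOn f (Ici 0)) (hg : ContinuousOn g (Ici 0))
    (hfb : ∀ t, 0 ≤ t → |f t| ≤ C) (hgb : ∀ t, 0 ≤ t → |g t| ≤ D)
    (hL : ∀ u, 0 < u → laplace f u = laplace g u) : EqOn f g (Ici 0) := by
  set K := max C D
  have hfi : ∀ u, 0 < u → LaplaceIntegrable f u := fun u hu => .of_continuousOn hu hf hfb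
  have hgi : ∀ u, 0 < u → LaplaceIntegrable g u := fun u hu => .of_continuousOn hu hg hgb
  have hshift : (fun t => f t + K) =ᵐ[volume.restrict (Ioi 0)] fun t => g t + K := by
    refine ae_eq_of_laplace_eq_of_nonneg (fun t ht => ?_) (fun t ht => ?_)
      ((hfi 1 one_pos).add (.const one_pos K)) ((hgi 1 one_pos).add (.const one_pos K))
      fun u hu => ?_
    · linarith [neg_le_of_abs_le (hfb t ht.le), le_max_left C D]
    · linarith [neg_le_of_abs_le (hgb t ht.le), le_max_right C D]
    · rw [laplace_add (hfi u hu) (.const hu K), laplace_add (hgi u hu) (.const hu K), hL u hu]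
  have hIoi : EqOn f g (Ioi 0) := by
    refine Measure.eqOn_of_ae_eq (μ := volume) ?_ (hf.mono Ioi_subset_Ici_self)
      (hg.mono Ioi_subset_Ici_self) (by rw [isOpen_Ioi.interior_eq]; exact subset_closure)
    filter_upwards [hshift] with t ht using add_right_cancel ht
  exact hIoi.of_subset_closure hf hg Ioi_subset_Ici_self (by rw [closure_Ioi])

end Uniqueness

theorem eq_add_fracInt {g D : ℝ → ℝ} {b t : ℝ} (hb0 : 0 < b) (hb1 : b ≤ 1) (ht : 0 ≤ t)
    (hac : AbsolutelyContinuousOnInterval g 0 t)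
    (hone : b = 1 → ∀ s, 0 < s → HasDerivAt g (D s) s)
    (hlt : b < 1 → ∀ s, 0 < s → D s = fracInt (1 - b) (deriv g) s) :
    g t = g 0 + fracInt b D t := by
  suffices fracInt b D t = g t - g 0 by rw [this, add_sub_cancel]
  rw [← hac.integral_deriv_eq_sub, ← fracInt_one]
  rcases hb1.eq_or_lt with rfl | hb1
  · exact fracInt_congr ht fun s hs _ => (hone rfl s hs).deriv.symm
  · rw [fracInt_congr ht fun s hs _ => hlt hb1 s hs,
      fracInt_fracInt hb0 (sub_pos.2 hb1) (by linarith) ht hac.intervalIntegrable_deriv,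
      add_sub_cancel]

theorem natCeil_eq_one {α : ℝ} (h0 : 0 < α) (h1 : α ≤ 1) : ⌈α⌉₊ = 1 :=
  (Nat.ceil_eq_iff one_ne_zero).2 (by simpa using ⟨h0, h1⟩)

theorem natCeil_eq_two {α : ℝ} (h1 : 1 < α) (h2 : α ≤ 2) : ⌈α⌉₊ = 2 :=
  (Nat.ceil_eq_iff two_ne_zero).2 (by simpa using ⟨h1, h2⟩)

theorem HasCaputoDeriv.eq_add_fracInt_of_le_one {α : ℝ} {f D : ℝ → ℝ} (hα0 : 0 < α) (hα1 : α ≤ 1)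
    (h : HasCaputoDeriv α f D) {t : ℝ} (ht : 0 ≤ t) : f t = f 0 + fracInt α D t := by
  rcases ht.eq_or_lt with rfl | ht
  · rw [fracInt_zero_right, add_zero]
  obtain ⟨-, hac, hone, -, hlt⟩ := h
  simp only [natCeil_eq_one hα0 hα1, Nat.cast_one, tsub_self, iteratedDerivWithin_zero]
    at hac hone hlt
  exact eq_add_fracInt hα0 hα1 ht.le (hac t ht) hone fun hα s hs => hlt hα.ne s hs

theorem HasCaputoDeriv.eq_add_fracInt_of_one_lt {α : ℝ} {f D : ℝ → ℝ} (hα1 : 1 < α) (hα2 : α ≤ 2)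
    (h : HasCaputoDeriv α f D) (hD : ContinuousOn D (Ici 0)) (h0 : HasDerivWithinAt f 0 (Ici 0) 0)
    {t : ℝ} (ht : 0 ≤ t) : f t = f 0 + fracInt α D t := by
  rcases ht.eq_or_lt with rfl | ht
  · rw [fracInt_zero_right, add_zero]
  obtain ⟨hcd, hac, hone, -, hlt⟩ := h
  simp only [natCeil_eq_two hα1 hα2, Nat.cast_ofNat, Nat.add_one_sub_one, iteratedDerivWithin_one,
    Nat.cast_one] at hcd hac hone hlt
  set f' := derivWithin f (Ici 0)
  have hf'0 : f' 0 = 0 := h0.derivWithin (uniqueDiffOn_Ici 0 0 self_mem_Ici)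
  have hf' : ∀ s, 0 < s → f' s = fracInt (α - 1) D s := fun s hs => by
    rw [eq_add_fracInt (sub_pos.2 hα1) (by linarith) hs.le (hac s hs)
      (fun hα => hone (by linarith)) fun hα r hr => ?_, hf'0, zero_add]
    rw [hlt (by linarith) r hr, fracInt, show 1 - (α - 1) = 2 - α by ring]
  have hderiv : ∀ s, 0 < s → HasDerivAt f (f' s) s := fun s hs =>
    (hcd.differentiableOn one_ne_zero s hs.le).hasDerivWithinAt.hasDerivAt (Ici_mem_nhds hs)
  have hftc : ∫ s in (0 : ℝ)..t, f' s = f t - f 0 :=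
    intervalIntegral.integral_eq_sub_of_hasDerivAt_of_le ht.le
      (hcd.continuousOn.mono Icc_subset_Ici_self) (fun s hs => hderiv s hs.1)
      (hac t ht).continuousOn.intervalIntegrable
  have hDi : IntervalIntegrable D volume 0 t :=
    (hD.mono (by rw [uIcc_of_le ht.le]; exact Icc_subset_Ici_self)).intervalIntegrable
  calc f t = f 0 + fracInt 1 (fracInt (α - 1) D) t := by
        rw [← fracInt_congr ht.le fun s hs _ => hf' s hs, fracInt_one, hftc, add_sub_cancel]
    _ = f 0 + fracInt α D t := by
        rw [fracInt_fracInt one_pos (sub_pos.2 hα1) (by linarith) ht.le hDi, add_sub_cancel]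

theorem absolutelyContinuousOnInterval_congr {f g : ℝ → ℝ} {a b : ℝ}
    (hf : AbsolutelyContinuousOnInterval f a b) (h : EqOn f g (uIcc a b)) :
    AbsolutelyContinuousOnInterval g a b := by
  rw [absolutelyContinuousOnInterval_iff] at hf ⊢
  intro ε hε
  obtain ⟨δ, hδ, H⟩ := hf ε hε
  refine ⟨δ, hδ, fun E hE hlt => (Finset.sum_congr rfl fun i hi => ?_).trans_lt (H E hE hlt)⟩
  obtain ⟨hl, hr⟩ := hE.1 i hi
  rw [h hl, h hr]

section Primitive

variable {f g : ℝ → ℝ} {t : ℝ}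

theorem eq_add_integral_of_hasDerivAt (ht : 0 ≤ t) (hf : ContinuousOn f (Ici 0))
    (hfg : ∀ s, 0 < s → HasDerivAt f (g s) s) (hg : IntervalIntegrable g volume 0 t) :
    f t = f 0 + ∫ s in (0 : ℝ)..t, g s := by
  rw [intervalIntegral.integral_eq_sub_of_hasDerivAt_of_le ht (hf.mono Icc_subset_Ici_self)
    (fun s hs => hfg s hs.1) hg, add_sub_cancel]

theorem laplace_deriv {u : ℝ} (hu : 0 < u) (hf : ContinuousOn f (Ici 0))
    (hfg : ∀ t, 0 < t → HasDerivAt f (g t) t) (hg : ∀ t, 0 < t → IntervalIntegrable g volume 0 t)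
    (hgL : LaplaceIntegrable g u) : laplace g u = u * laplace f u - f 0 := by
  have h : laplace f u = f 0 / u + u ^ (-1 : ℝ) * laplace g u :=
    laplace_eq_of_eq_const_add_fracInt one_pos hu hgL fun t ht => by
      rw [fracInt_one]
      exact eq_add_integral_of_hasDerivAt ht.le hf hfg (hg t ht)
  rw [h, Real.rpow_neg_one]
  field_simp
  ring

theorem absolutelyContinuousOnInterval_of_hasDerivAt (ht : 0 ≤ t) (hf : ContinuousOn f (Ici 0))
    (hfg : ∀ s, 0 < s → HasDerivAt f (g s) s) (hg : IntervalIntegrable g volume 0 t) :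
    AbsolutelyContinuousOnInterval f 0 t := by
  have hprim := hg.absolutelyContinuousOnInterval_intervalIntegral (c := 0) left_mem_uIcc
  have hconst : AbsolutelyContinuousOnInterval (fun _ : ℝ => f 0) 0 t :=
    ((LipschitzWith.const (f 0)).lipschitzOnWith (s := uIcc 0 t)).absolutelyContinuousOnInterval
  refine absolutelyContinuousOnInterval_congr (hconst.fun_add hprim) fun s hs => ?_
  rw [uIcc_of_le ht] at hs
  refine (eq_add_integral_of_hasDerivAt hs.1 hf hfg (hg.mono_set ?_)).symm
  rw [uIcc_of_le hs.1, uIcc_of_le ht]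
  exact Icc_subset_Icc_right hs.2

theorem hasCaputoDeriv_of_le_one {ν : ℝ} {D : ℝ → ℝ} (hν0 : 0 < ν) (hν1 : ν ≤ 1)
    (hf : ContinuousOn f (Ici 0)) (hfg : ∀ t, 0 < t → HasDerivAt f (g t) t)
    (hg : ∀ t, 0 < t → IntervalIntegrable g volume 0 t) (hone : ν = 1 → ∀ t, 0 < t → g t = D t)
    (hint : ν < 1 → ∀ t, 0 < t →
      IntervalIntegrable (fun s => g s * (t - s) ^ (1 - ν - 1)) volume 0 t)
    (hlt : ν < 1 → ∀ t, 0 < t → D t = fracInt (1 - ν) g t) : HasCaputoDeriv ν f D := by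
  have hderiv : ∀ t, 0 < t → deriv f t = g t := fun t ht => (hfg t ht).deriv
  constructor <;> simp only [natCeil_eq_one hν0 hν1, Nat.cast_one, tsub_self,
    iteratedDerivWithin_zero]
  · simpa using hf
  · exact fun t ht => absolutelyContinuousOnInterval_of_hasDerivAt ht.le hf hfg (hg t ht)
  · exact fun h t ht => hone h t ht ▸ hfg t ht
  · refine fun h t ht => (hint (hν1.lt_of_ne h) t ht).congr fun s hs => ?_
    rw [uIoc_of_le ht.le] at hs
    simp only [hderiv s hs.1]
  · intro h t ht
    rw [hlt (hν1.lt_of_ne h) t ht]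
    exact (fracInt_congr ht.le fun s hs _ => hderiv s hs).symm

end Primitive

/-- The integral of `r ↦ m (t r)` over `[0, 1]` against the unnormalised beta weight with
parameters `a`, `b`; up to a power of `t`, this is the fractional integral of order `b` of
`s ↦ s ^ (a - 1) m(s)`. -/
def betaMean (a b : ℝ) (m : ℝ → ℝ) (t : ℝ) : ℝ :=
  ∫ r in (0 : ℝ)..1, r ^ (a - 1) * (1 - r) ^ (b - 1) * m (t * r)

section BetaMean

variable {a b t C : ℝ} {m g : ℝ → ℝ}

theorem intervalIntegrable_mul_sub_rpow (ha : 0 < a) (hb : 0 < b) (ht : 0 < t)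
    (hg : AEStronglyMeasurable g (volume.restrict (Ioi 0)))
    (hgb : ∀ s, 0 < s → |g s| ≤ C * s ^ (a - 1)) :
    IntervalIntegrable (fun s => g s * (t - s) ^ (b - 1)) volume 0 t := by
  have hbeta := intervalIntegrable_sub_rpow_mul_sub_rpow hb ha ht
  rw [intervalIntegrable_iff_integrableOn_Ioc_of_le ht.le] at hbeta ⊢
  refine (hbeta.const_mul C).mono' ((hg.mono_set Ioc_subset_Ioi_self).mul
    (by fun_prop : Measurable fun s => (t - s) ^ (b - 1)).aestronglyMeasurable) ?_
  filter_upwards [ae_restrict_mem measurableSet_Ioc] with s hs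
  rw [sub_zero, ← mul_assoc]
  have hsub := Real.rpow_nonneg (sub_nonneg.2 hs.2) (b - 1)
  rw [norm_mul, Real.norm_of_nonneg hsub]
  exact mul_le_mul_of_nonneg_right (hgb s hs.1) hsub

theorem fracInt_rpow_mul (ht : 0 < t) (a b : ℝ) (m : ℝ → ℝ) :
    fracInt b (fun s => s ^ (a - 1) * m s) t
      = t ^ (a + b - 1) / Real.Gamma b * betaMean a b m t := by
  have hsubst := intervalIntegral.integral_comp_mul_left (a := 0) (b := 1)
    (fun s => s ^ (a - 1) * m s * (t - s) ^ (b - 1)) ht.ne'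
  rw [mul_zero, mul_one, smul_eq_mul, eq_comm, inv_mul_eq_iff_eq_mul₀ ht.ne'] at hsubst
  rw [fracInt, hsubst, betaMean, ← intervalIntegral.integral_const_mul,
    ← intervalIntegral.integral_const_mul, ← intervalIntegral.integral_const_mul]
  refine intervalIntegral.integral_congr fun r hr => ?_
  rw [uIcc_of_le zero_le_one] at hr
  have hpow : t ^ (a + b - 1) = t * t ^ (a - 1) * t ^ (b - 1) := by
    rw [show a + b - 1 = 1 + (a - 1) + (b - 1) by ring, Real.rpow_add ht, Real.rpow_add ht,
      Real.rpow_one]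
  rw [show t - t * r = t * (1 - r) by ring, Real.mul_rpow ht.le hr.1,
    Real.mul_rpow ht.le (sub_nonneg.2 hr.2), hpow]
  ring

theorem norm_betaMean_integrand_le (ht : 0 ≤ t) (hC : ∀ s, 0 ≤ s → |m s| ≤ C) {r : ℝ}
    (hr : r ∈ Ioc (0 : ℝ) 1) :
    ‖r ^ (a - 1) * (1 - r) ^ (b - 1) * m (t * r)‖ ≤ r ^ (a - 1) * (1 - r) ^ (b - 1) * C := by
  have hw : 0 ≤ r ^ (a - 1) * (1 - r) ^ (b - 1) :=
    mul_nonneg (Real.rpow_nonneg hr.1.le _) (Real.rpow_nonneg (sub_nonneg.2 hr.2) _)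
  rw [norm_mul, Real.norm_of_nonneg hw]
  exact mul_le_mul_of_nonneg_left (hC _ (mul_nonneg ht hr.1.le)) hw

theorem intervalIntegrable_betaWeight (ha : 0 < a) (hb : 0 < b) :
    IntervalIntegrable (fun r : ℝ => r ^ (a - 1) * (1 - r) ^ (b - 1)) volume 0 1 := by
  simpa using intervalIntegrable_sub_rpow_mul_sub_rpow hb ha one_pos

theorem continuousOn_betaMean (ha : 0 < a) (hb : 0 < b) (hm : ContinuousOn m (Ici 0))
    (hC : ∀ s, 0 ≤ s → |m s| ≤ C) : ContinuousOn (betaMean a b m) (Ici 0) := by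
  have hw := (intervalIntegrable_betaWeight ha hb).1
  unfold betaMean
  simp only [intervalIntegral.integral_of_le zero_le_one]
  refine continuousOn_of_dominated (fun t ht => ?_) (fun t ht => ?_) (hw.mul_const C) ?_
  · exact hw.aestronglyMeasurable.mul <| ContinuousOn.aestronglyMeasurable
      (hm.comp (by fun_prop) fun r hr => mul_nonneg ht hr.1.le) measurableSet_Ioc
  · filter_upwards [ae_restrict_mem measurableSet_Ioc] with r hr
    exact norm_betaMean_integrand_le ht hC hr
  · filter_upwards [ae_restrict_mem measurableSet_Ioc] with r hr
    exact continuousOn_const.mul (hm.comp (by fun_prop) fun t ht => mul_nonneg ht hr.1.le)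

theorem abs_betaMean_le (ha : 0 < a) (hb : 0 < b) (ht : 0 ≤ t) (hC : ∀ s, 0 ≤ s → |m s| ≤ C) :
    |betaMean a b m t| ≤ beta a b * C := by
  have hbeta := integral_rpow_mul_sub_rpow ha hb one_pos
  rw [Real.one_rpow, one_mul] at hbeta
  rw [← hbeta, ← intervalIntegral.integral_mul_const, ← Real.norm_eq_abs]
  exact intervalIntegral.norm_integral_le_of_norm_le zero_le_one
    (Eventually.of_forall fun r hr => norm_betaMean_integrand_le ht hC hr)
    ((intervalIntegrable_betaWeight ha hb).mul_const C)

end BetaMean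

-- `fracInt (1 - ν) (s ^ (ν - 1) * m s)` is `betaMean ν (1 - ν) m / Γ(1 - ν)`, a bounded continuous
-- function, so that it is determined by its Laplace transform.
theorem eq_fracInt_rpow_mul_of_laplace_eq {ν C B : ℝ} {m D : ℝ → ℝ} (hν0 : 0 < ν) (hν1 : ν < 1)
    (hm : ContinuousOn m (Ici 0)) (hC : ∀ t, 0 ≤ t → |m t| ≤ C)
    (hD : ContinuousOn D (Ici 0)) (hB : ∀ t, 0 ≤ t → |D t| ≤ B)
    (hi : ∀ u, 0 < u → LaplaceIntegrable (fun s => s ^ (ν - 1) * m s) u)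
    (hL : ∀ u, 0 < u → laplace (fun s => s ^ (ν - 1) * m s) u = u ^ (1 - ν) * laplace D u)
    {t : ℝ} (ht : 0 < t) : D t = fracInt (1 - ν) (fun s => s ^ (ν - 1) * m s) t := by
  have hb := sub_pos.2 hν1
  have hfrac : ∀ s, 0 < s → fracInt (1 - ν) (fun s => s ^ (ν - 1) * m s) s
      = 1 / Real.Gamma (1 - ν) * betaMean ν (1 - ν) m s := fun s hs => by
    rw [fracInt_rpow_mul hs, add_sub_cancel, sub_self, Real.rpow_zero]
  rw [hfrac t ht]
  refine eqOn_of_laplace_eq (g := fun s => 1 / Real.Gamma (1 - ν) * betaMean ν (1 - ν) m s)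
    (D := |1 / Real.Gamma (1 - ν)| * (beta ν (1 - ν) * C)) hD
    (continuousOn_const.mul (continuousOn_betaMean hν0 hb hm hC)) hB (fun s hs => ?_)
    (fun u hu => ?_) ht.le
  · rw [abs_mul]
    exact mul_le_mul_of_nonneg_left (abs_betaMean_le hν0 hb hs hC) (abs_nonneg _)
  · rw [← laplace_congr hfrac, laplace_fracInt hb hu (hi u hu), hL u hu, ← mul_assoc,
      ← Real.rpow_add hu, neg_add_cancel, Real.rpow_zero, one_mul]

theorem hasCaputoDeriv_of_laplace_eq {ν C B : ℝ} {f m D : ℝ → ℝ} (hν0 : 0 < ν) (hν1 : ν ≤ 1)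
    (hf : ContinuousOn f (Ici 0)) (hfm : ∀ t, 0 < t → HasDerivAt f (t ^ (ν - 1) * m t) t)
    (hm : ContinuousOn m (Ici 0)) (hC : ∀ t, 0 ≤ t → |m t| ≤ C)
    (hD : ContinuousOn D (Ici 0)) (hB : ∀ t, 0 ≤ t → |D t| ≤ B)
    (hL : ∀ u, 0 < u → laplace f u = f 0 / u + u ^ (-ν) * laplace D u) :
    HasCaputoDeriv ν f D := by
  set g : ℝ → ℝ := fun s => s ^ (ν - 1) * m s with hg
  have hgm : AEStronglyMeasurable g (volume.restrict (Ioi 0)) :=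
    AEStronglyMeasurable.mul (by fun_prop)
      ((hm.mono Ioi_subset_Ici_self).aestronglyMeasurable measurableSet_Ioi)
  have hgb : ∀ t, 0 < t → |g t| ≤ C * t ^ (ν - 1) := fun t ht => by
    have hpow := Real.rpow_pos_of_pos ht (ν - 1)
    rw [hg, abs_mul, abs_of_pos hpow, mul_comm]
    exact mul_le_mul_of_nonneg_right (hC t ht.le) hpow.le
  have hgi : ∀ t, 0 < t → IntervalIntegrable g volume 0 t := fun t ht => by
    simpa using intervalIntegrable_mul_sub_rpow hν0 one_pos ht hgm hgb
  have hgL : ∀ u, 0 < u → LaplaceIntegrable g u := fun u hu => .of_le_mul_rpow hν0 hu hgm hgb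
  have hlaplace : ∀ u, 0 < u → laplace g u = u ^ (1 - ν) * laplace D u := fun u hu => by
    rw [laplace_deriv hu hf hfm hgi (hgL u hu), hL u hu, sub_eq_add_neg 1 ν, Real.rpow_add hu,
      Real.rpow_one]
    field_simp
    ring
  refine hasCaputoDeriv_of_le_one hν0 hν1 hf hfm hgi ?_ (fun hlt t ht =>
    intervalIntegrable_mul_sub_rpow hν0 (sub_pos.2 hlt) ht hgm hgb) ?_
  · rintro rfl t ht
    have hgm : ∀ t, 0 < t → g t = m t := fun t _ => by simp [hg]
    refine (hgm t ht).trans (eqOn_of_laplace_eq hm hD hC hB (fun u hu => ?_) ht.le)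
    rw [← laplace_congr hgm, hlaplace u hu, sub_self, Real.rpow_zero, one_mul]
  · exact fun hlt t ht => eq_fracInt_rpow_mul_of_laplace_eq hν0 hlt hm hC hD hB hgL hlaplace ht

section TestFunctions

open scoped ContDiff

variable {φ f g : ℝ → ℝ}

theorem hasCompactSupport_iteratedDeriv (hφ : HasCompactSupport φ) (n : ℕ) :
    HasCompactSupport (iteratedDeriv n φ) := by
  induction n with
  | zero => simpa using hφ
  | succ n ih => simpa only [iteratedDeriv_succ] using ih.deriv

theorem contDiff_iteratedDeriv (hφ : ContDiff ℝ ∞ φ) (n : ℕ) :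
    ContDiff ℝ ∞ (iteratedDeriv n φ) := by
  rw [iteratedDeriv_eq_iterate]
  exact hφ.iterate_deriv n

theorem exists_abs_iteratedDeriv_le (hφ : ContDiff ℝ ∞ φ) (hs : HasCompactSupport φ) (k : ℕ) :
    ∃ B, ∀ i ≤ k, ∀ x, |iteratedDeriv i φ x| ≤ B := by
  choose B hB using fun i => (hasCompactSupport_iteratedDeriv hs i).exists_bound_of_continuous
    (contDiff_iteratedDeriv hφ i).continuous
  refine ⟨∑ i ∈ Finset.range (k + 1), B i, fun i hi x => (hB i x).trans ?_⟩
  exact Finset.single_le_sum (fun j _ => (norm_nonneg _).trans (hB j 0))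
    (Finset.mem_range.2 (by lia))

theorem abs_iteratedDeriv_comp_mul_le {k i : ℕ} {B K c : ℝ} (hφ : ContDiff ℝ ∞ φ) (hK : 1 ≤ K)
    (hc : |c| ≤ K) (hB : ∀ i ≤ k, ∀ x, |iteratedDeriv i φ x| ≤ B) (hi : i ≤ k) (x : ℝ) :
    |iteratedDeriv i (fun x => φ (c * x)) x| ≤ K ^ k * B := by
  rw [iteratedDeriv_comp_const_mul (contDiff_infty.1 hφ i), abs_mul, abs_pow]
  have hpow : |c| ^ i ≤ K ^ k :=
    (pow_le_pow_left₀ (abs_nonneg c) hc i).trans (pow_le_pow_right₀ hK hi)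
  exact mul_le_mul hpow (hB i hi _) (abs_nonneg _) (by positivity)

theorem abs_iteratedDeriv_two_mul_le {x M B : ℝ} (hf : ContDiff ℝ 2 f) (hg : ContDiff ℝ 2 g)
    (hfM : ∀ i ≤ 2, |iteratedDeriv i f x| ≤ M) (hgB : ∀ i ≤ 2, |iteratedDeriv i g x| ≤ B) :
    |iteratedDeriv 2 (fun y => f y * g y) x| ≤ 4 * (M * B) := by
  have hM : 0 ≤ M := (abs_nonneg _).trans (hfM 0 zero_le_two)
  have hprod : ∀ i j, i ≤ 2 → j ≤ 2 → |iteratedDeriv i f x * iteratedDeriv j g x| ≤ M * B := by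
    intro i j hi hj
    rw [abs_mul]
    exact mul_le_mul (hfM i hi) (hgB j hj) (abs_nonneg _) hM
  have h02 := abs_le.1 (hprod 0 2 zero_le_two le_rfl)
  have h11 := abs_le.1 (hprod 1 1 one_le_two one_le_two)
  have h20 := abs_le.1 (hprod 2 0 le_rfl zero_le_two)
  have hleibniz : iteratedDeriv 2 (fun y => f y * g y) x
      = iteratedDeriv 0 f x * iteratedDeriv 2 g x
        + 2 * (iteratedDeriv 1 f x * iteratedDeriv 1 g x)
        + iteratedDeriv 2 f x * iteratedDeriv 0 g x := by
    rw [iteratedDeriv_fun_mul hf.contDiffAt hg.contDiffAt]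
    simp [Finset.sum_range_succ, mul_assoc]
  rw [hleibniz, abs_le]
  constructor <;> linarith

end TestFunctions

/-- A smooth cutoff function, equal to `1` on `[-1, 1]` and to `0` outside `(-2, 2)`. -/
def cutoff : ContDiffBump (0 : ℝ) := ⟨1, 2, one_pos, one_lt_two⟩

/-- The cutoff function dilated by `n + 1`; as `n → ∞` these increase to all of `ℝ`. -/
def cutoffSeq (n : ℕ) (x : ℝ) : ℝ := cutoff (((n : ℝ) + 1)⁻¹ * x)

section Cutoff

open scoped ContDiff

variable (n : ℕ) (x : ℝ)

theorem contDiff_cutoffSeq : ContDiff ℝ ∞ (cutoffSeq n) :=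
  cutoff.contDiff.comp (contDiff_const.mul contDiff_id)

theorem hasCompactSupport_cutoffSeq : HasCompactSupport (cutoffSeq n) :=
  cutoff.hasCompactSupport.comp_homeomorph
    (Homeomorph.mulLeft₀ ((n : ℝ) + 1)⁻¹ (inv_ne_zero n.cast_add_one_ne_zero))

theorem cutoffSeq_nonneg : 0 ≤ cutoffSeq n x := cutoff.nonneg

theorem abs_cutoffSeq_le_one : |cutoffSeq n x| ≤ 1 :=
  (abs_of_nonneg (cutoffSeq_nonneg n x)).trans_le cutoff.le_one

theorem cutoff_eq_one {x : ℝ} (h : |x| ≤ 1) : cutoff x = 1 :=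
  cutoff.one_of_mem_closedBall (by simpa [cutoff] using h)

theorem cutoffSeq_zero : cutoffSeq n 0 = 1 := cutoff_eq_one (by simp)

theorem abs_one_sub_cutoffSeq_le : |1 - cutoffSeq n x| ≤ ((n : ℝ) + 1)⁻¹ ^ 2 * x ^ 2 := by
  rw [← mul_pow, cutoffSeq]
  generalize ((n : ℝ) + 1)⁻¹ * x = y
  rcases le_or_gt |y| 1 with hy | hy
  · simpa [cutoff_eq_one hy] using sq_nonneg y
  · have hnonneg : 0 ≤ cutoff y := cutoff.nonneg
    rw [abs_of_nonneg (sub_nonneg.2 cutoff.le_one)]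
    nlinarith [sq_abs y]

theorem inv_succ_le_one : |((n : ℝ) + 1)⁻¹| ≤ 1 := by
  rw [abs_of_pos (by positivity)]
  exact inv_le_one_of_one_le₀ (by simp)

theorem exists_abs_iteratedDeriv_cutoffSeq_le (k : ℕ) :
    ∃ B, ∀ n, ∀ i ≤ k, ∀ x, |iteratedDeriv i (cutoffSeq n) x| ≤ B := by
  obtain ⟨B, hB⟩ := exists_abs_iteratedDeriv_le cutoff.contDiff cutoff.hasCompactSupport k
  exact ⟨1 ^ k * B, fun n i hi x =>
    abs_iteratedDeriv_comp_mul_le cutoff.contDiff le_rfl (inv_succ_le_one n) hB hi x⟩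

theorem exists_abs_iteratedDeriv_two_sq_mul_cutoffSeq_le :
    ∃ B, ∀ n x, |iteratedDeriv 2 (fun x => x ^ 2 * cutoffSeq n x) x| ≤ B := by
  have hη : ContDiff ℝ ∞ fun x : ℝ => x ^ 2 * cutoff x := (contDiff_id.pow 2).mul cutoff.contDiff
  obtain ⟨B, hB⟩ := exists_abs_iteratedDeriv_le hη cutoff.hasCompactSupport.mul_left 2
  refine ⟨B, fun n x => ?_⟩
  have hscale : (fun x => x ^ 2 * cutoffSeq n x) = fun x =>
      ((n : ℝ) + 1) ^ 2 * ((((n : ℝ) + 1)⁻¹ * x) ^ 2 * cutoff (((n : ℝ) + 1)⁻¹ * x)) := by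
    ext x
    rw [cutoffSeq, mul_pow, ← mul_assoc, ← mul_assoc, ← mul_pow,
      mul_inv_cancel₀ n.cast_add_one_ne_zero, one_pow, one_mul]
  rw [hscale, iteratedDeriv_const_mul_field,
    iteratedDeriv_comp_const_mul (f := fun y => y ^ 2 * cutoff y) (contDiff_infty.1 hη 2),
    ← mul_assoc, ← mul_pow, mul_inv_cancel₀ n.cast_add_one_ne_zero, one_pow, one_mul]
  exact hB 2 le_rfl _

theorem tendsto_inv_succ : Tendsto (fun n : ℕ => ((n : ℝ) + 1)⁻¹) atTop (𝓝 0) := by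
  simpa only [one_div] using tendsto_one_div_add_atTop_nhds_zero_nat (𝕜 := ℝ)

theorem eventually_cutoffSeq_eventuallyEq_one : ∀ᶠ n in atTop, cutoffSeq n =ᶠ[𝓝 x] 1 := by
  have hlim : Tendsto (fun n : ℕ => ((n : ℝ) + 1)⁻¹ * x) atTop (𝓝 0) := by
    simpa using tendsto_inv_succ.mul_const x
  filter_upwards [hlim.eventually (Metric.ball_mem_nhds 0 one_pos)] with n hn
  have hcont : Continuous fun y : ℝ => ((n : ℝ) + 1)⁻¹ * y := by fun_prop
  filter_upwards [hcont.continuousAt.eventually (Metric.isOpen_ball.mem_nhds hn)] with y hy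
  exact cutoff_eq_one (by simpa using (Metric.mem_ball.1 hy).le)

theorem tendsto_mul_cutoffSeq (c : ℝ) : Tendsto (fun n => c * cutoffSeq n x) atTop (𝓝 c) := by
  refine tendsto_const_nhds.congr' ?_
  filter_upwards [eventually_cutoffSeq_eventuallyEq_one x] with n hn
  rw [hn.self_of_nhds, Pi.one_apply, mul_one]

theorem tendsto_iteratedDeriv_mul_cutoffSeq (ψ : ℝ → ℝ) (k : ℕ) :
    Tendsto (fun n => iteratedDeriv k (fun y => ψ y * cutoffSeq n y) x) atTop
      (𝓝 (iteratedDeriv k ψ x)) := by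
  refine tendsto_const_nhds.congr' ?_
  filter_upwards [eventually_cutoffSeq_eventuallyEq_one x] with n hn
  refine EventuallyEq.iteratedDeriv_eq k ?_
  filter_upwards [hn] with y hy
  rw [hy, Pi.one_apply, mul_one]

end Cutoff

theorem abs_integral_mul_cutoffSeq_sub_le {m : Measure ℝ} [IsFiniteMeasure m] {ψ : ℝ → ℝ} {M : ℝ}
    (hψ : Continuous ψ) (hM : ∀ x, |ψ x| ≤ M) (hm : Integrable (fun x => x ^ 2) m) (n : ℕ) :
    |∫ x, ψ x * cutoffSeq n x ∂m - ∫ x, ψ x ∂m| ≤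
      M * (∫ x, x ^ 2 ∂m) * ((n : ℝ) + 1)⁻¹ ^ 2 := by
  have hψi : Integrable ψ m :=
    .of_bound hψ.aestronglyMeasurable M (Eventually.of_forall hM)
  have hψχ : Integrable (fun x => ψ x * cutoffSeq n x) m :=
    hψi.mul_bdd (contDiff_cutoffSeq n).continuous.aestronglyMeasurable
      (Eventually.of_forall fun x => abs_cutoffSeq_le_one n x)
  rw [← integral_sub hψχ hψi, mul_assoc, ← integral_mul_const, ← integral_const_mul,
    ← Real.norm_eq_abs]
  refine norm_integral_le_of_norm_le ((hm.mul_const _).const_mul M)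
    (Eventually.of_forall fun x => ?_)
  calc ‖ψ x * cutoffSeq n x - ψ x‖ = |ψ x| * |1 - cutoffSeq n x| := by
        rw [← mul_sub_one, norm_mul, norm_sub_rev, Real.norm_eq_abs, Real.norm_eq_abs]
    _ ≤ M * (((n : ℝ) + 1)⁻¹ ^ 2 * x ^ 2) :=
        mul_le_mul (hM x) (abs_one_sub_cutoffSeq_le n x) (abs_nonneg _)
          ((abs_nonneg _).trans (hM x))
    _ = M * (x ^ 2 * ((n : ℝ) + 1)⁻¹ ^ 2) := by ring

theorem lintegral_ofReal_le_of_tendsto {X : Type*} [MeasurableSpace X] {m : Measure X}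
    {g : ℕ → X → ℝ} {f : X → ℝ} {K : ℝ} (hg : ∀ n, Integrable (g n) m) (h0 : ∀ n x, 0 ≤ g n x)
    (hK : ∀ n, ∫ x, g n x ∂m ≤ K) (hlim : ∀ x, Tendsto (fun n => g n x) atTop (𝓝 (f x))) :
    ∫⁻ x, ENNReal.ofReal (f x) ∂m ≤ ENNReal.ofReal K := by
  have hfatou := lintegral_liminf_le' (u := atTop) fun n => (hg n).aemeasurable.ennreal_ofReal
  simp only [(ENNReal.tendsto_ofReal (hlim _)).liminf_eq] at hfatou
  refine hfatou.trans (liminf_le_of_frequently_le' (Frequently.of_forall fun n => ?_))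
  rw [← ofReal_integral_eq_lintegral_ofReal (hg n) (Eventually.of_forall (h0 n))]
  exact ENNReal.ofReal_le_ofReal (hK n)

namespace IsFundamentalSolution

open scoped ContDiff

variable {α M : ℝ} {q : ℝ → Measure ℝ} {φ ψ : ℝ → ℝ}

theorem integral_zero (hq : IsFundamentalSolution α q) (φ : ℝ → ℝ) : ∫ x, φ x ∂(q 0) = φ 0 := by
  rw [hq.initial, integral_dirac]

theorem abs_integral_le (hq : IsFundamentalSolution α q) {t : ℝ} (ht : 0 ≤ t)
    (hM : ∀ x, |ψ x| ≤ M) : |∫ x, ψ x ∂(q t)| ≤ M := by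
  have := hq.isProbabilityMeasure t ht
  have hle := norm_integral_le_of_norm_le_const (μ := q t) (f := ψ) (Eventually.of_forall hM)
  simpa using hle

theorem continuousOn_integral_test (hq : IsFundamentalSolution α q) (hφ : ContDiff ℝ ∞ φ)
    (hs : HasCompactSupport φ) : ContinuousOn (fun t => ∫ x, φ x ∂(q t)) (Ici 0) :=
  (hq.equation φ hφ hs).contDiffOn.continuousOn

theorem integral_test_eq (hq : IsFundamentalSolution α q) (hα0 : 0 < α) (hα2 : α ≤ 2)
    (hφ : ContDiff ℝ ∞ φ) (hs : HasCompactSupport φ) {t : ℝ} (ht : 0 ≤ t) :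
    ∫ x, φ x ∂(q t) = φ 0 + fracInt α (fun s => ∫ x, iteratedDeriv 2 φ x ∂(q s)) t := by
  rw [← hq.integral_zero φ]
  rcases le_or_gt α 1 with h1 | h1
  · exact (hq.equation φ hφ hs).eq_add_fracInt_of_le_one hα0 h1 ht
  · exact (hq.equation φ hφ hs).eq_add_fracInt_of_one_lt h1 hα2
      (hq.continuousOn_integral_test (contDiff_iteratedDeriv hφ 2)
        (hasCompactSupport_iteratedDeriv hs 2)) (hq.initial_deriv h1 φ hφ hs) ht

theorem exists_lintegral_sq_le (hq : IsFundamentalSolution α q) (hα0 : 0 < α) (hα2 : α ≤ 2) :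
    ∃ C, 0 ≤ C ∧ ∀ t, 0 ≤ t → ∫⁻ x, ENNReal.ofReal (x ^ 2) ∂(q t) ≤ ENNReal.ofReal (C * t ^ α) := by
  obtain ⟨B, hB⟩ := exists_abs_iteratedDeriv_two_sq_mul_cutoffSeq_le
  have hB0 : 0 ≤ B := (abs_nonneg _).trans (hB 0 0)
  refine ⟨B / Real.Gamma (α + 1), div_nonneg hB0 (Real.Gamma_pos_of_pos (by linarith)).le,
    fun t ht => ?_⟩
  have := hq.isProbabilityMeasure t ht
  have hsmooth : ∀ n, ContDiff ℝ ∞ fun x => x ^ 2 * cutoffSeq n x := fun n =>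
    (contDiff_id.pow 2).mul (contDiff_cutoffSeq n)
  have hcompact : ∀ n, HasCompactSupport fun x => x ^ 2 * cutoffSeq n x := fun n =>
    (hasCompactSupport_cutoffSeq n).mul_left
  refine lintegral_ofReal_le_of_tendsto
    (fun n => (hsmooth n).continuous.integrable_of_hasCompactSupport (hcompact n))
    (fun n x => mul_nonneg (sq_nonneg x) (cutoffSeq_nonneg n x)) (fun n => ?_)
    (fun x => tendsto_mul_cutoffSeq x (x ^ 2))
  rw [hq.integral_test_eq hα0 hα2 (hsmooth n) (hcompact n) ht, zero_pow two_ne_zero, zero_mul,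
    zero_add, div_mul_eq_mul_div]
  exact (le_abs_self _).trans
    (abs_fracInt_le hα0 ht fun s hs _ => hq.abs_integral_le hs.le (hB n))

theorem integrable_sq (hq : IsFundamentalSolution α q) (hα0 : 0 < α) (hα2 : α ≤ 2) {t : ℝ}
    (ht : 0 ≤ t) : Integrable (fun x => x ^ 2) (q t) := by
  obtain ⟨C, -, hC⟩ := hq.exists_lintegral_sq_le hα0 hα2
  refine ⟨by fun_prop, ?_⟩
  rw [hasFiniteIntegral_iff_ofReal (Eventually.of_forall fun x => sq_nonneg x)]
  exact (hC t ht).trans_lt ENNReal.ofReal_lt_top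

theorem exists_integral_sq_le (hq : IsFundamentalSolution α q) (hα0 : 0 < α) (hα2 : α ≤ 2) :
    ∃ C, 0 ≤ C ∧ ∀ t, 0 ≤ t → ∫ x, x ^ 2 ∂(q t) ≤ C * t ^ α := by
  obtain ⟨C, hC0, hC⟩ := hq.exists_lintegral_sq_le hα0 hα2
  refine ⟨C, hC0, fun t ht => ?_⟩
  rw [← ENNReal.ofReal_le_ofReal_iff (by positivity), ofReal_integral_eq_lintegral_ofReal
    (hq.integrable_sq hα0 hα2 ht) (Eventually.of_forall fun x => sq_nonneg x)]
  exact hC t ht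

theorem integrable_abs (hq : IsFundamentalSolution α q) (hα0 : 0 < α) (hα2 : α ≤ 2) {t : ℝ}
    (ht : 0 ≤ t) : Integrable (fun x => |x|) (q t) := by
  have := hq.isProbabilityMeasure t ht
  have hL2 : MemLp (fun x : ℝ => x) 2 (q t) :=
    (memLp_two_iff_integrable_sq aestronglyMeasurable_id).2 (hq.integrable_sq hα0 hα2 ht)
  exact (hL2.integrable one_le_two).abs

theorem exists_abs_integral_mul_cutoffSeq_sub_le (hq : IsFundamentalSolution α q) (hα0 : 0 < α)
    (hα2 : α ≤ 2) (hψ : Continuous ψ) (hM : ∀ x, |ψ x| ≤ M) : ∃ C, 0 ≤ C ∧ ∀ t, 0 ≤ t → ∀ n,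
      |∫ x, ψ x * cutoffSeq n x ∂(q t) - ∫ x, ψ x ∂(q t)| ≤ C * t ^ α * ((n : ℝ) + 1)⁻¹ ^ 2 := by
  obtain ⟨C, hC0, hC⟩ := hq.exists_integral_sq_le hα0 hα2
  have hM0 : 0 ≤ M := (abs_nonneg _).trans (hM 0)
  refine ⟨M * C, by positivity, fun t ht n => ?_⟩
  have := hq.isProbabilityMeasure t ht
  refine (abs_integral_mul_cutoffSeq_sub_le hψ hM (hq.integrable_sq hα0 hα2 ht) n).trans ?_
  rw [mul_assoc M C]
  gcongr
  exact hC t ht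

theorem tendsto_integral_mul_cutoffSeq (hq : IsFundamentalSolution α q) (hα0 : 0 < α)
    (hα2 : α ≤ 2) (hψ : Continuous ψ) (hM : ∀ x, |ψ x| ≤ M) :
    TendstoLocallyUniformlyOn (fun n t => ∫ x, ψ x * cutoffSeq n x ∂(q t))
      (fun t => ∫ x, ψ x ∂(q t)) atTop (Ici 0) := by
  obtain ⟨C, hC0, hC⟩ := hq.exists_abs_integral_mul_cutoffSeq_sub_le hα0 hα2 hψ hM
  rw [Metric.tendstoLocallyUniformlyOn_iff]
  intro ε hε t _
  refine ⟨Iio (t + 1) ∩ Ici 0, inter_mem (mem_nhdsWithin_of_mem_nhds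
    (Iio_mem_nhds (lt_add_one t))) self_mem_nhdsWithin, ?_⟩
  have hlim : Tendsto (fun n : ℕ => C * (t + 1) ^ α * ((n : ℝ) + 1)⁻¹ ^ 2) atTop (𝓝 0) := by
    simpa using (tendsto_inv_succ.pow 2).const_mul (C * (t + 1) ^ α)
  filter_upwards [hlim.eventually (gt_mem_nhds hε)] with n hn s hs
  rw [dist_comm, Real.dist_eq]
  refine (hC s hs.2 n).trans_lt (hn.trans_le' ?_)
  have hmono : s ^ α ≤ (t + 1) ^ α := Real.rpow_le_rpow hs.2 (le_of_lt hs.1) hα0.le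
  gcongr

theorem continuousOn_integral (hq : IsFundamentalSolution α q) (hα0 : 0 < α) (hα2 : α ≤ 2)
    (hψ : ContDiff ℝ ∞ ψ) (hM : ∀ x, |ψ x| ≤ M) :
    ContinuousOn (fun t => ∫ x, ψ x ∂(q t)) (Ici 0) :=
  (hq.tendsto_integral_mul_cutoffSeq hα0 hα2 hψ.continuous hM).continuousOn
    (Frequently.of_forall fun n => hq.continuousOn_integral_test (hψ.mul (contDiff_cutoffSeq n))
      (hasCompactSupport_cutoffSeq n).mul_left)

theorem integral_eq (hq : IsFundamentalSolution α q) (hα0 : 0 < α) (hα2 : α ≤ 2)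
    (hψ : ContDiff ℝ ∞ ψ) (hM : ∀ i ≤ 2, ∀ x, |iteratedDeriv i ψ x| ≤ M) {t : ℝ} (ht : 0 ≤ t) :
    ∫ x, ψ x ∂(q t) = ψ 0 + fracInt α (fun s => ∫ x, iteratedDeriv 2 ψ x ∂(q s)) t := by
  obtain ⟨B, hB⟩ := exists_abs_iteratedDeriv_cutoffSeq_le 2
  have hφ : ∀ n, ContDiff ℝ ∞ fun y => ψ y * cutoffSeq n y := fun n =>
    hψ.mul (contDiff_cutoffSeq n)
  have hφc : ∀ n, HasCompactSupport fun y => ψ y * cutoffSeq n y := fun n =>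
    (hasCompactSupport_cutoffSeq n).mul_left
  have hφ2 : ∀ n x, |iteratedDeriv 2 (fun y => ψ y * cutoffSeq n y) x| ≤ 4 * (M * B) := fun n x =>
    abs_iteratedDeriv_two_mul_le (contDiff_infty.1 hψ 2) (contDiff_infty.1 (contDiff_cutoffSeq n) 2)
      (fun i hi => hM i hi x) (fun i hi => hB n i hi x)
  have hrhs : Tendsto (fun n => ψ 0 + fracInt α
        (fun s => ∫ x, iteratedDeriv 2 (fun y => ψ y * cutoffSeq n y) x ∂(q s)) t) atTop
      (𝓝 (ψ 0 + fracInt α (fun s => ∫ x, iteratedDeriv 2 ψ x ∂(q s)) t)) := by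
    refine (tendsto_fracInt (C := 4 * (M * B)) hα0 ht (fun n => ?_)
      (fun n s hs => hq.abs_integral_le hs (hφ2 n)) fun s hs => ?_).const_add _
    · exact hq.continuousOn_integral_test (contDiff_iteratedDeriv (hφ n) 2)
        (hasCompactSupport_iteratedDeriv (hφc n) 2)
    · have := hq.isProbabilityMeasure s hs
      exact tendsto_integral_of_dominated_convergence (fun _ => 4 * (M * B))
        (fun n => (contDiff_iteratedDeriv (hφ n) 2).continuous.aestronglyMeasurable)
        (integrable_const _) (fun n => Eventually.of_forall (hφ2 n))
        (Eventually.of_forall fun x => tendsto_iteratedDeriv_mul_cutoffSeq x ψ 2)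
  have hψM : ∀ x, |ψ x| ≤ M := fun x => by simpa using hM 0 zero_le_two x
  refine tendsto_nhds_unique
    ((hq.tendsto_integral_mul_cutoffSeq hα0 hα2 hψ.continuous hψM).tendsto_at ht)
    (hrhs.congr fun n => ?_)
  rw [hq.integral_test_eq hα0 hα2 (hφ n) (hφc n) ht, cutoffSeq_zero, mul_one]

theorem mul_laplace_integral_of_iteratedDeriv_two_eq (hq : IsFundamentalSolution α q) (hα0 : 0 < α)
    (hα2 : α ≤ 2) {ξ u : ℝ} (hψ : ContDiff ℝ ∞ ψ)
    (hM : ∀ i ≤ 2, ∀ x, |iteratedDeriv i ψ x| ≤ M)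
    (heig : ∀ x, iteratedDeriv 2 ψ x = -ξ ^ 2 * ψ x) (hu : 0 < u) :
    u * laplace (fun t => ∫ x, ψ x ∂(q t)) u = ψ 0 / (1 + ξ ^ 2 * u ^ (-α)) := by
  have hψM : ∀ x, |ψ x| ≤ M := fun x => by simpa using hM 0 zero_le_two x
  have hL := laplace_eq_of_eq_const_add_fracInt (f := fun t => ∫ x, ψ x ∂(q t))
    (g := fun t => -ξ ^ 2 * ∫ x, ψ x ∂(q t)) (c := ψ 0) hα0 hu
    (LaplaceIntegrable.const_mul (.of_continuousOn hu (hq.continuousOn_integral hα0 hα2 hψ hψM)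
      fun t ht => hq.abs_integral_le ht hψM) _) fun t ht => by
      simpa only [heig, integral_const_mul] using hq.integral_eq hα0 hα2 hψ hM ht.le
  rw [laplace_const_mul] at hL
  have hpos : 0 < 1 + ξ ^ 2 * u ^ (-α) := by positivity
  set L := laplace (fun t => ∫ x, ψ x ∂(q t)) u
  have hmul : u * L = u * (ψ 0 / u + u ^ (-α) * (-ξ ^ 2 * L)) := congrArg (u * ·) hL
  rw [mul_add, mul_div_cancel₀ _ hu.ne'] at hmul
  rw [eq_div_iff hpos.ne']
  linarith

end IsFundamentalSolution

section FoldedLaws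

variable {m n : Measure ℝ} [IsFiniteMeasure m] [IsFiniteMeasure n]

theorem integrable_exp_mul_I (m : Measure ℝ) [IsFiniteMeasure m] (ξ : ℝ) :
    Integrable (fun x : ℝ => Complex.exp (ξ * x * Complex.I)) m := by
  refine .of_bound (C := 1) (by fun_prop) (Eventually.of_forall fun x => ?_)
  rw [← Complex.ofReal_mul, Complex.norm_exp_ofReal_mul_I]

theorem re_charFun (m : Measure ℝ) [IsFiniteMeasure m] (ξ : ℝ) :
    (charFun m ξ).re = ∫ x, Real.cos (ξ * x) ∂m := by
  rw [charFun_apply_real, ← RCLike.re_eq_complex_re, ← integral_re (integrable_exp_mul_I m ξ)]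
  refine integral_congr_ae (Eventually.of_forall fun x => ?_)
  simp only [RCLike.re_eq_complex_re, ← Complex.ofReal_mul, Complex.exp_ofReal_mul_I_re]

theorem charFun_add_map_neg (m : Measure ℝ) [IsFiniteMeasure m] (ξ : ℝ) :
    charFun (m + m.map Neg.neg) ξ = ((2 * ∫ x, Real.cos (ξ * x) ∂m : ℝ) : ℂ) := by
  have hneg : charFun (m.map Neg.neg) ξ = (starRingEnd ℂ) (charFun m ξ) := by
    rw [← charFun_neg, ← neg_one_mul ξ, ← charFun_map_mul,
      funext fun x : ℝ => (neg_one_mul x : -1 * x = Neg.neg x)]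
  have hadd : charFun (m + m.map Neg.neg) ξ = charFun m ξ + charFun (m.map Neg.neg) ξ := by
    simp only [charFun_apply_real]
    exact integral_add_measure (integrable_exp_mul_I _ ξ) (integrable_exp_mul_I _ ξ)
  rw [hadd, hneg, Complex.add_conj, re_charFun]

theorem add_map_neg_apply_preimage_abs (m : Measure ℝ) {s : Set ℝ} (hs : MeasurableSet s) :
    (m + m.map Neg.neg) (abs ⁻¹' s) = 2 * m (abs ⁻¹' s) := by
  have hneg : Neg.neg ⁻¹' (abs ⁻¹' s) = abs ⁻¹' s := by
    ext x
    simp only [mem_preimage, abs_neg]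
  rw [Measure.add_apply, Measure.map_apply measurable_neg (continuous_abs.measurable hs), hneg,
    two_mul]

theorem map_abs_eq_of_integral_cos_eq
    (h : ∀ ξ, ∫ x, Real.cos (ξ * x) ∂m = ∫ x, Real.cos (ξ * x) ∂n) : m.map abs = n.map abs := by
  have hsymm : m + m.map Neg.neg = n + n.map Neg.neg :=
    Measure.ext_of_charFun (funext fun ξ => by rw [charFun_add_map_neg, charFun_add_map_neg, h])
  refine Measure.ext fun s hs => ?_
  have habs : Measurable (abs : ℝ → ℝ) := continuous_abs.measurable
  rw [Measure.map_apply habs hs, Measure.map_apply habs hs,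
    ← ENNReal.mul_right_inj two_ne_zero ENNReal.ofNat_ne_top,
    ← add_map_neg_apply_preimage_abs m hs, ← add_map_neg_apply_preimage_abs n hs, hsymm]

theorem integral_comp_abs_eq_of_integral_cos_eq {f : ℝ → ℝ} (hf : Continuous fun x => f |x|)
    (h : ∀ ξ, ∫ x, Real.cos (ξ * x) ∂m = ∫ x, Real.cos (ξ * x) ∂n) :
    ∫ x, f |x| ∂m = ∫ x, f |x| ∂n := by
  have hfold : ∀ ρ : Measure ℝ, ∫ x, f |x| ∂ρ = ∫ y, f |y| ∂(ρ.map abs) := fun ρ => by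
    rw [integral_map continuous_abs.aemeasurable hf.aestronglyMeasurable]
    simp only [abs_abs]
  rw [hfold m, hfold n, map_abs_eq_of_integral_cos_eq h]

end FoldedLaws

section ExponentialLaw

variable {u : ℝ}

theorem expMeasure_eq_withDensity (u : ℝ) :
    expMeasure u = (volume.restrict (Ioi 0)).withDensity
      fun t => ENNReal.ofReal (u * Real.exp (-(u * t))) := by
  have hIci : volume.restrict (Ioi (0 : ℝ)) = volume.restrict (Ici 0) :=
    Measure.restrict_congr_set Ioi_ae_eq_Ici
  rw [hIci, ← withDensity_indicator measurableSet_Ici]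
  refine congrArg volume.withDensity (funext fun t => (exponentialPDF_eq u t).trans ?_)
  rw [indicator_apply, apply_ite ENNReal.ofReal, ENNReal.ofReal_zero]
  rfl

theorem integral_expMeasure (hu : 0 < u) (g : ℝ → ℝ) :
    ∫ t, g t ∂(expMeasure u) = u * laplace g u := by
  rw [expMeasure_eq_withDensity, integral_withDensity_eq_integral_toReal_smul (by fun_prop)
    (Eventually.of_forall fun _ => ENNReal.ofReal_lt_top), laplace, ← integral_const_mul]
  refine integral_congr_ae (Eventually.of_forall fun t => ?_)
  simp only
  rw [ENNReal.toReal_ofReal (by positivity), smul_eq_mul, mul_assoc]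

theorem ae_expMeasure_pos (u : ℝ) : ∀ᵐ t ∂(expMeasure u), 0 < t := by
  rw [expMeasure_eq_withDensity]
  exact (withDensity_absolutelyContinuous _ _).ae_le (ae_restrict_mem measurableSet_Ioi)

theorem laplace_cos (hu : 0 < u) (ξ : ℝ) :
    laplace (fun s => Real.cos (ξ * s)) u = u / (u ^ 2 + ξ ^ 2) := by
  set z : ℂ := -u + ξ * Complex.I with hz
  have hzre : z.re = -u := by simp [hz]
  have hre : z.re < 0 := by rwa [hzre, neg_lt_zero]
  have hexp : ∀ s : ℝ, Real.exp (-(u * s)) * Real.cos (ξ * s) = (Complex.exp (z * s)).re := by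
    intro s
    rw [Complex.exp_re]
    simp [hz]
  have hnorm : Complex.normSq z = u ^ 2 + ξ ^ 2 := by
    simp [hz, Complex.normSq_apply, pow_two]
  have hint := integral_re (integrableOn_exp_mul_complex_Ioi hre 0)
  rw [integral_exp_mul_complex_Ioi hre 0] at hint
  simp only [RCLike.re_eq_complex_re, ← hexp] at hint
  rw [laplace, hint, Complex.ofReal_zero, mul_zero, Complex.exp_zero, Complex.div_re,
    hnorm, hzre]
  simp

theorem integral_cos_expMeasure (hu : 0 < u) (ξ : ℝ) :
    ∫ t, Real.cos (ξ * t) ∂(expMeasure u) = 1 / (1 + ξ ^ 2 * (u ^ 2)⁻¹) := by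
  rw [integral_expMeasure hu, laplace_cos hu]
  field_simp

theorem integral_comp_abs_expMeasure (hu : 0 < u) (f : ℝ → ℝ) :
    ∫ t, f |t| ∂(expMeasure u) = u * laplace f u := by
  rw [integral_expMeasure hu, laplace_congr fun t ht => by rw [abs_of_pos ht]]

end ExponentialLaw

namespace IsFundamentalSolution

section Cosine

variable {α : ℝ} {q : ℝ → Measure ℝ}

theorem continuousOn_integral_cos (hq : IsFundamentalSolution α q) (hα0 : 0 < α) (hα2 : α ≤ 2)
    (ξ : ℝ) : ContinuousOn (fun t => ∫ x, Real.cos (ξ * x) ∂(q t)) (Ici 0) :=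
  hq.continuousOn_integral hα0 hα2 (by fun_prop) fun _ => Real.abs_cos_le_one _

theorem mul_laplace_integral_cos (hq : IsFundamentalSolution α q) (hα0 : 0 < α) (hα2 : α ≤ 2)
    (ξ : ℝ) {u : ℝ} (hu : 0 < u) :
    u * laplace (fun t => ∫ x, Real.cos (ξ * x) ∂(q t)) u = 1 / (1 + ξ ^ 2 * u ^ (-α)) := by
  have hM : ∀ i ≤ 2, ∀ x, |iteratedDeriv i (fun x => Real.cos (ξ * x)) x| ≤ (max 1 |ξ|) ^ 2 * 1 :=
    fun i hi x => abs_iteratedDeriv_comp_mul_le Real.contDiff_cos (le_max_left _ _)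
      (le_max_right _ _) (fun j _ y => Real.abs_iteratedDeriv_cos_le_one j y) hi x
  have heig : ∀ x, iteratedDeriv 2 (fun x => Real.cos (ξ * x)) x
      = -ξ ^ 2 * Real.cos (ξ * x) := fun x => by
    rw [iteratedDeriv_comp_const_mul Real.contDiff_cos]
    simp [iteratedDeriv_succ]
  simpa using hq.mul_laplace_integral_of_iteratedDeriv_two_eq hα0 hα2 (by fun_prop) hM heig hu

end Cosine

variable {ν C u t : ℝ} {q : ℝ → Measure ℝ} {f g : ℝ → ℝ}

theorem integral_cos_eq_integral_cos_rpow_mul (hq : IsFundamentalSolution (2 * ν) q) (hν0 : 0 < ν)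
    (hν1 : ν ≤ 1) (ξ : ℝ) (ht : 0 ≤ t) :
    ∫ x, Real.cos (ξ * x) ∂(q t) = ∫ x, Real.cos (ξ * t ^ ν * x) ∂(q 1) := by
  rcases ht.eq_or_lt with rfl | ht
  · have := hq.isProbabilityMeasure 1 zero_le_one
    simp [hq.integral_zero, Real.zero_rpow hν0.ne']
  have hα0 : 0 < 2 * ν := by linarith
  have hα2 : 2 * ν ≤ 2 := by linarith
  have hcont : ContinuousOn (fun s => ∫ x, Real.cos (ξ * x) ∂(q (t * s))) (Ici 0) :=
    (hq.continuousOn_integral_cos hα0 hα2 ξ).comp (f := fun s => t * s) (by fun_prop)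
      fun s hs => mul_nonneg ht.le hs
  have hlaplace : ∀ u, 0 < u → laplace (fun s => ∫ x, Real.cos (ξ * x) ∂(q (t * s))) u
      = laplace (fun s => ∫ x, Real.cos (ξ * t ^ ν * x) ∂(q s)) u := by
    intro u hu
    have hscale : (ξ * t ^ ν) ^ 2 * u ^ (-(2 * ν)) = ξ ^ 2 * (u / t) ^ (-(2 * ν)) := by
      rw [Real.div_rpow hu.le ht.le, Real.rpow_neg ht.le, div_inv_eq_mul, mul_pow,
        mul_comm 2 ν, Real.rpow_mul ht.le, Real.rpow_two, mul_right_comm, mul_assoc]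
    have hrhs := hq.mul_laplace_integral_cos hα0 hα2 (ξ * t ^ ν) hu
    rw [hscale, ← hq.mul_laplace_integral_cos hα0 hα2 ξ (div_pos hu ht)] at hrhs
    rw [laplace_comp_mul_left (fun s => ∫ x, Real.cos (ξ * x) ∂(q s)) ht]
    refine mul_left_cancel₀ hu.ne' (Eq.trans ?_ hrhs.symm)
    field_simp
  simpa using eqOn_of_laplace_eq hcont (hq.continuousOn_integral_cos hα0 hα2 (ξ * t ^ ν))
    (fun s hs => hq.abs_integral_le (mul_nonneg ht.le hs) fun x => Real.abs_cos_le_one _)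
    (fun s hs => hq.abs_integral_le hs fun x => Real.abs_cos_le_one _) hlaplace
    (mem_Ici.2 zero_le_one)

theorem integral_comp_abs_eq (hq : IsFundamentalSolution (2 * ν) q) (hν0 : 0 < ν) (hν1 : ν ≤ 1)
    (hf : Continuous fun x => f |x|) (ht : 0 ≤ t) :
    ∫ x, f |x| ∂(q t) = ∫ x, f (t ^ ν * |x|) ∂(q 1) := by
  have := hq.isProbabilityMeasure t ht
  have := hq.isProbabilityMeasure 1 zero_le_one
  have hmap : ∀ {h : ℝ → ℝ}, Continuous h →
      ∫ x, h x ∂((q 1).map (t ^ ν * ·)) = ∫ x, h (t ^ ν * x) ∂(q 1) := fun hh =>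
    integral_map (by fun_prop) hh.aestronglyMeasurable
  rw [integral_comp_abs_eq_of_integral_cos_eq (n := (q 1).map (t ^ ν * ·)) hf fun ξ => ?_,
    hmap hf]
  · simp only [abs_mul, abs_of_nonneg (Real.rpow_nonneg ht ν)]
  · rw [hmap (by fun_prop), hq.integral_cos_eq_integral_cos_rpow_mul hν0 hν1 ξ ht]
    simp only [mul_assoc]

theorem integral_map_expMeasure_prod (hq : IsFundamentalSolution (2 * ν) q) (hν0 : 0 < ν)
    (hν1 : ν ≤ 1) (hu : 0 < u) (hf : Continuous fun x => f |x|) (hC : ∀ s, 0 ≤ s → |f s| ≤ C) :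
    ∫ x, f |x| ∂(((expMeasure u).prod (q 1)).map fun p => p.1 ^ ν * p.2)
      = u * laplace (fun t => ∫ x, f |x| ∂(q t)) u := by
  have := isProbabilityMeasure_expMeasure hu
  have := hq.isProbabilityMeasure 1 zero_le_one
  have hmul : Measurable fun p : ℝ × ℝ => p.1 ^ ν * p.2 := by fun_prop
  have hint : Integrable (fun p : ℝ × ℝ => f |p.1 ^ ν * p.2|) ((expMeasure u).prod (q 1)) :=
    .of_bound (hf.measurable.comp hmul).aestronglyMeasurable C
      (Eventually.of_forall fun p => hC _ (abs_nonneg _))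
  rw [integral_map hmul.aemeasurable hf.aestronglyMeasurable, integral_prod _ hint,
    ← integral_expMeasure hu]
  refine integral_congr_ae ?_
  filter_upwards [ae_expMeasure_pos u] with t ht
  rw [hq.integral_comp_abs_eq hν0 hν1 hf ht.le]
  simp only [abs_mul, abs_of_nonneg (Real.rpow_nonneg ht.le ν)]

-- The law of `|x|` under `q`, sampled at an independent exponential time of rate `u`, is
-- exponential of rate `u ^ ν`; both sides are expectations under this law.
theorem mul_laplace_integral_comp_abs (hq : IsFundamentalSolution (2 * ν) q) (hν0 : 0 < ν)
    (hν1 : ν ≤ 1) (hf : ContinuousOn f (Ici 0)) (hC : ∀ s, 0 ≤ s → |f s| ≤ C) (hu : 0 < u) :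
    u * laplace (fun t => ∫ x, f |x| ∂(q t)) u = u ^ ν * laplace f (u ^ ν) := by
  have ha : 0 < u ^ ν := Real.rpow_pos_of_pos hu ν
  have := isProbabilityMeasure_expMeasure hu
  have := isProbabilityMeasure_expMeasure ha
  have := hq.isProbabilityMeasure 1 zero_le_one
  have hfc : Continuous fun x => f |x| := hf.comp_continuous continuous_abs fun x => abs_nonneg x
  rw [← hq.integral_map_expMeasure_prod hν0 hν1 hu hfc hC, ← integral_comp_abs_expMeasure ha]
  refine integral_comp_abs_eq_of_integral_cos_eq hfc fun ξ => ?_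
  have heven : ∀ x, Real.cos (ξ * |x|) = Real.cos (ξ * x) := fun x => by
    rw [← Real.cos_abs, abs_mul, abs_abs, ← abs_mul, Real.cos_abs]
  have hcos := hq.integral_map_expMeasure_prod (f := fun s => Real.cos (ξ * s)) hν0 hν1 hu
    (by fun_prop) fun s _ => Real.abs_cos_le_one _
  simp only [heven] at hcos
  rw [hcos, hq.mul_laplace_integral_cos (by linarith) (by linarith) ξ hu,
    integral_cos_expMeasure ha, Real.rpow_neg hu.le, mul_comm 2 ν, Real.rpow_mul hu.le,
    Real.rpow_two]

end IsFundamentalSolution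

section ScaledAverage

variable {m : Measure ℝ} {f d w k : ℝ → ℝ} {ν C D t : ℝ}

theorem rpow_mul_abs_nonneg (ν : ℝ) (ht : 0 ≤ t) (x : ℝ) : 0 ≤ t ^ ν * |x| :=
  mul_nonneg (Real.rpow_nonneg ht ν) (abs_nonneg x)

theorem continuous_comp_rpow_mul_abs (hk : ContinuousOn k (Ici 0)) (ν : ℝ) (ht : 0 ≤ t) :
    Continuous fun x => k (t ^ ν * |x|) :=
  hk.comp_continuous (by fun_prop) (rpow_mul_abs_nonneg ν ht)

theorem continuousOn_integral_comp_rpow_mul_abs (hν : 0 < ν) (hw : Integrable w m)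
    (hk : ContinuousOn k (Ici 0)) (hD : ∀ s, 0 ≤ s → |k s| ≤ D) :
    ContinuousOn (fun t => ∫ x, w x * k (t ^ ν * |x|) ∂m) (Ici 0) := by
  refine continuousOn_of_dominated (bound := fun x => ‖w x‖ * D)
    (fun t ht => hw.aestronglyMeasurable.mul
      (continuous_comp_rpow_mul_abs hk ν ht).aestronglyMeasurable)
    (fun t ht => Eventually.of_forall fun x => ?_) (hw.norm.mul_const D)
    (Eventually.of_forall fun x => continuousOn_const.mul (hk.comp (t := Ici 0) ?_
      fun t ht => rpow_mul_abs_nonneg ν ht x))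
  · rw [norm_mul]
    exact mul_le_mul_of_nonneg_left (hD _ (rpow_mul_abs_nonneg ν ht x)) (norm_nonneg _)
  · exact ((Real.continuous_rpow_const hν.le).mul continuous_const).continuousOn

theorem hasDerivAt_comp_rpow_mul_abs (hfd : ∀ s, 0 < s → HasDerivAt f (d s) s) (ν : ℝ)
    (ht : 0 < t) (x : ℝ) :
    HasDerivAt (fun t => f (t ^ ν * |x|)) (ν * t ^ (ν - 1) * (|x| * d (t ^ ν * |x|))) t := by
  rcases eq_or_ne x 0 with rfl | hx
  · simpa using hasDerivAt_const t (f 0)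
  · have hinner := (Real.hasDerivAt_rpow_const (p := ν) (Or.inl ht.ne')).mul_const |x|
    have houter := hfd (t ^ ν * |x|) (mul_pos (Real.rpow_pos_of_pos ht _) (abs_pos.2 hx))
    exact (houter.comp t hinner).congr_deriv (by ring)

theorem hasDerivAt_integral_comp_rpow_mul_abs [IsFiniteMeasure m] (hν0 : 0 < ν) (hν1 : ν ≤ 1)
    (hm : Integrable (fun x => |x|) m) (hf : ContinuousOn f (Ici 0)) (hd : ContinuousOn d (Ici 0))
    (hfd : ∀ s, 0 < s → HasDerivAt f (d s) s) (hC : ∀ s, 0 ≤ s → |f s| ≤ C)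
    (hD : ∀ s, 0 ≤ s → |d s| ≤ D) (ht : 0 < t) :
    HasDerivAt (fun t => ∫ x, f (t ^ ν * |x|) ∂m)
      (t ^ (ν - 1) * (ν * ∫ x, |x| * d (t ^ ν * |x|) ∂m)) t := by
  have hpos : ∀ s ∈ Ioi (t / 2), 0 < s := fun s hs => (half_pos ht).trans hs
  have hbound : ∀ x, ∀ s ∈ Ioi (t / 2),
      ‖ν * s ^ (ν - 1) * (|x| * d (s ^ ν * |x|))‖ ≤ ν * (t / 2) ^ (ν - 1) * D * |x| := by
    intro x s hs
    have hpow : s ^ (ν - 1) ≤ (t / 2) ^ (ν - 1) :=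
      Real.rpow_le_rpow_of_nonpos (half_pos ht) (le_of_lt hs) (by linarith)
    rw [Real.norm_eq_abs, abs_mul, abs_mul, abs_mul, abs_abs, abs_of_pos hν0,
      abs_of_pos (Real.rpow_pos_of_pos (hpos s hs) _)]
    calc ν * s ^ (ν - 1) * (|x| * |d (s ^ ν * |x|)|)
        ≤ ν * (t / 2) ^ (ν - 1) * (|x| * D) := by
          gcongr
          exact hD _ (rpow_mul_abs_nonneg ν (hpos s hs).le x)
      _ = ν * (t / 2) ^ (ν - 1) * D * |x| := by ring
  have hderiv := (hasDerivAt_integral_of_dominated_loc_of_deriv_le (μ := m)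
    (F := fun s x => f (s ^ ν * |x|)) (F' := fun s x => ν * s ^ (ν - 1) * (|x| * d (s ^ ν * |x|)))
    (Ioi_mem_nhds (half_lt_self ht))
    (by filter_upwards [Ioi_mem_nhds ht] with s hs using
      (continuous_comp_rpow_mul_abs hf ν hs.le).aestronglyMeasurable)
    (.of_bound (continuous_comp_rpow_mul_abs hf ν ht.le).aestronglyMeasurable C
      (Eventually.of_forall fun x => hC _ (rpow_mul_abs_nonneg ν ht.le x)))
    (continuous_const.mul
      (continuous_abs.mul (continuous_comp_rpow_mul_abs hd ν ht.le))).aestronglyMeasurable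
    (Eventually.of_forall hbound) (hm.const_mul _)
    (Eventually.of_forall fun x s hs => hasDerivAt_comp_rpow_mul_abs hfd ν (hpos s hs) x)).2
  rw [integral_const_mul] at hderiv
  exact hderiv.congr_deriv (by ring)

theorem abs_integral_abs_mul_le (hm : Integrable (fun x => |x|) m) (hD : ∀ x, |k x| ≤ D) :
    |∫ x, |x| * k x ∂m| ≤ (∫ x, |x| ∂m) * D := by
  rw [← integral_mul_const, ← Real.norm_eq_abs]
  refine norm_integral_le_of_norm_le (hm.mul_const D) (Eventually.of_forall fun x => ?_)
  rw [norm_mul, Real.norm_eq_abs, abs_abs]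
  exact mul_le_mul_of_nonneg_left (hD x) (abs_nonneg x)

end ScaledAverage

namespace IsFundamentalSolution

variable {ν C D : ℝ} {q : ℝ → Measure ℝ} {f d : ℝ → ℝ}

theorem integral_comp_abs_eq_of_continuousOn (hq : IsFundamentalSolution (2 * ν) q) (hν0 : 0 < ν)
    (hν1 : ν ≤ 1) (hf : ContinuousOn f (Ici 0)) {t : ℝ} (ht : 0 ≤ t) :
    ∫ x, f |x| ∂(q t) = ∫ x, f (t ^ ν * |x|) ∂(q 1) :=
  hq.integral_comp_abs_eq hν0 hν1 (hf.comp_continuous continuous_abs fun x => abs_nonneg x) ht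

theorem continuousOn_integral_comp_abs (hq : IsFundamentalSolution (2 * ν) q) (hν0 : 0 < ν)
    (hν1 : ν ≤ 1) (hf : ContinuousOn f (Ici 0)) (hC : ∀ s, 0 ≤ s → |f s| ≤ C) :
    ContinuousOn (fun t => ∫ x, f |x| ∂(q t)) (Ici 0) := by
  have := hq.isProbabilityMeasure 1 zero_le_one
  refine (continuousOn_integral_comp_rpow_mul_abs (m := q 1) (w := fun _ => 1) hν0
    (integrable_const 1) hf hC).congr fun t ht => ?_
  simp only [one_mul, hq.integral_comp_abs_eq_of_continuousOn hν0 hν1 hf ht]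

theorem laplace_integral_comp_abs (hq : IsFundamentalSolution (2 * ν) q) (hν0 : 0 < ν)
    (hν1 : ν ≤ 1) (hf : ContinuousOn f (Ici 0)) (hd : ContinuousOn d (Ici 0))
    (hfd : ∀ s, 0 < s → HasDerivAt f (d s) s) (hC : ∀ s, 0 ≤ s → |f s| ≤ C)
    (hD : ∀ s, 0 ≤ s → |d s| ≤ D) {u : ℝ} (hu : 0 < u) :
    laplace (fun t => ∫ x, f |x| ∂(q t)) u
      = f 0 / u + u ^ (-ν) * laplace (fun t => ∫ x, d |x| ∂(q t)) u := by
  have ha := Real.rpow_pos_of_pos hu ν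
  have hderiv : laplace d (u ^ ν) = u ^ ν * laplace f (u ^ ν) - f 0 :=
    laplace_deriv ha hf hfd (fun t ht => (hd.mono
      ((uIcc_of_le ht.le).trans_subset Icc_subset_Ici_self)).intervalIntegrable)
      (.of_continuousOn ha hd hD)
  refine mul_left_cancel₀ hu.ne' ?_
  rw [mul_add, mul_left_comm u (u ^ (-ν)), hq.mul_laplace_integral_comp_abs hν0 hν1 hf hC hu,
    hq.mul_laplace_integral_comp_abs hν0 hν1 hd hD hu, hderiv, Real.rpow_neg hu.le,
    inv_mul_cancel_left₀ ha.ne', mul_div_cancel₀ _ hu.ne', add_sub_cancel]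

theorem hasCaputoDeriv_integral_comp_abs (hq : IsFundamentalSolution (2 * ν) q) (hν0 : 0 < ν)
    (hν1 : ν ≤ 1) (hf : ContinuousOn f (Ici 0)) (hd : ContinuousOn d (Ici 0))
    (hfd : ∀ s, 0 < s → HasDerivAt f (d s) s) (hC : ∀ s, 0 ≤ s → |f s| ≤ C)
    (hD : ∀ s, 0 ≤ s → |d s| ≤ D) :
    HasCaputoDeriv ν (fun t => ∫ x, f |x| ∂(q t)) (fun t => ∫ x, d |x| ∂(q t)) := by
  have := hq.isProbabilityMeasure 1 zero_le_one
  have hq1 : Integrable (fun x => |x|) (q 1) :=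
    hq.integrable_abs (by linarith) (by linarith) zero_le_one
  refine hasCaputoDeriv_of_laplace_eq (m := fun t => ν * ∫ x, |x| * d (t ^ ν * |x|) ∂(q 1))
    (C := |ν| * ((∫ x, |x| ∂(q 1)) * D)) hν0 hν1
    (hq.continuousOn_integral_comp_abs hν0 hν1 hf hC) (fun t ht => ?_)
    (continuousOn_const.mul (continuousOn_integral_comp_rpow_mul_abs hν0 hq1 hd hD))
    (fun t ht => ?_) (hq.continuousOn_integral_comp_abs hν0 hν1 hd hD)
    (fun t ht => hq.abs_integral_le ht fun x => hD _ (abs_nonneg x)) fun u hu => ?_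
  · refine (hasDerivAt_integral_comp_rpow_mul_abs hν0 hν1 hq1 hf hd hfd hC hD
      ht).congr_of_eventuallyEq ?_
    filter_upwards [Ioi_mem_nhds ht] with s hs using
      hq.integral_comp_abs_eq_of_continuousOn hν0 hν1 hf hs.le
  · rw [abs_mul]
    exact mul_le_mul_of_nonneg_left (abs_integral_abs_mul_le hq1 fun x =>
      hD _ (rpow_mul_abs_nonneg ν ht x)) (abs_nonneg ν)
  · rw [hq.laplace_integral_comp_abs hν0 hν1 hf hd hfd hC hD hu, hq.integral_zero, abs_zero]

end IsFundamentalSolution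

/-- The operator on sequences in Kolmogorov's forward equations of the linear birth–death process:
the right-hand side of the system is `kolmogorovForward birth death (fun j => p j t) k`. At `k = 1`
the index `k - 1 = 0` has coefficient `0`, so for `k ≥ 1` the value `x 0` is irrelevant. -/
def kolmogorovForward (birth death : ℝ) (x : ℕ → ℝ) (k : ℕ) : ℝ :=
  -(birth + death) * k * x k + birth * ((k : ℝ) - 1) * x (k - 1)
    + death * ((k : ℝ) + 1) * x (k + 1)

section KolmogorovForward

variable {birth death : ℝ} {k : ℕ}

theorem kolmogorovForward_sub (x y : ℕ → ℝ) (k : ℕ) :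
    kolmogorovForward birth death (fun j => x j - y j) k
      = kolmogorovForward birth death x k - kolmogorovForward birth death y k := by
  simp only [kolmogorovForward]
  ring

theorem mul_kolmogorovForward (c : ℝ) (x : ℕ → ℝ) (k : ℕ) :
    c * kolmogorovForward birth death x k
      = kolmogorovForward birth death (fun j => c * x j) k := by
  simp only [kolmogorovForward]
  ring

theorem abs_kolmogorovForward_le {x : ℕ → ℝ} (hx : ∀ j, |x j| ≤ 1) (k : ℕ) :
    |kolmogorovForward birth death x k|
      ≤ |-(birth + death) * k| + |birth * ((k : ℝ) - 1)| + |death * ((k : ℝ) + 1)| := by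
  have hterm : ∀ (c : ℝ) (j : ℕ), |c * x j| ≤ |c| := fun c j => by
    rw [abs_mul]
    exact mul_le_of_le_one_right (abs_nonneg c) (hx j)
  exact (abs_add_three _ _ _).trans (add_le_add_three (hterm _ _) (hterm _ _) (hterm _ _))

theorem continuousOn_kolmogorovForward {α : Type*} [TopologicalSpace α] {s : Set α}
    {h : ℕ → α → ℝ} (hh : ∀ j, 1 ≤ j → ContinuousOn (h j) s) (hk : 1 ≤ k) :
    ContinuousOn (fun a => kolmogorovForward birth death (fun j => h j a) k) s := by
  have hpred : ContinuousOn (fun a => birth * ((k : ℝ) - 1) * h (k - 1) a) s := by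
    rcases hk.eq_or_lt with rfl | hk
    · simpa using continuousOn_const
    · exact continuousOn_const.mul (hh _ (by lia))
  exact ((continuousOn_const.mul (hh k hk)).add hpred).add
    (continuousOn_const.mul (hh (k + 1) (by lia)))

section Integral

variable {α : Type*} [MeasurableSpace α] {m : Measure α} {h : ℕ → α → ℝ}

theorem integrable_mul_pred (hh : ∀ j, 1 ≤ j → Integrable (h j) m) (hk : 1 ≤ k) :
    Integrable (fun a => birth * ((k : ℝ) - 1) * h (k - 1) a) m := by
  rcases hk.eq_or_lt with rfl | hk
  · simp
  · exact (hh _ (by lia)).const_mul _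

theorem integrable_kolmogorovForward (hh : ∀ j, 1 ≤ j → Integrable (h j) m) (hk : 1 ≤ k) :
    Integrable (fun a => kolmogorovForward birth death (fun j => h j a) k) m :=
  (((hh k hk).const_mul _).add (integrable_mul_pred hh hk)).add
    ((hh (k + 1) (by lia)).const_mul _)

theorem integral_kolmogorovForward (hh : ∀ j, 1 ≤ j → Integrable (h j) m) (hk : 1 ≤ k) :
    ∫ a, kolmogorovForward birth death (fun j => h j a) k ∂m
      = kolmogorovForward birth death (fun j => ∫ a, h j a ∂m) k := by
  have hself := (hh k hk).const_mul (-(birth + death) * k)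
  have hpred := integrable_mul_pred (birth := birth) hh hk
  have hsucc := (hh (k + 1) (by lia)).const_mul (death * ((k : ℝ) + 1))
  have hsplit := (integral_add (hself.add hpred) hsucc).trans
    (congrArg (· + _) (integral_add hself hpred))
  simp only [integral_const_mul] at hsplit
  exact hsplit

end Integral

end KolmogorovForward

section Resolvent

variable {birth death a : ℝ} {x : ℕ → ℝ}

theorem sum_abs_le_of_resolvent (hb : 0 ≤ birth) (hd : 0 ≤ death) (ha : 0 ≤ a)
    (hx : ∀ k, 1 ≤ k → a * x k = kolmogorovForward birth death x k) (n : ℕ) :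
    a * ∑ j ∈ Finset.range n, |x (j + 1)| + birth * n * |x n| ≤ death * (n + 1) * |x (n + 1)| := by
  induction n with
  | zero => simpa using mul_nonneg hd (abs_nonneg (x 1))
  | succ n ih =>
    have hres : (a + (birth + death) * (n + 1)) * x (n + 1)
        = birth * n * x n + death * (n + 2) * x (n + 2) := by
      have h := hx (n + 1) (by lia)
      simp only [kolmogorovForward, Nat.add_sub_cancel] at h
      push_cast at h
      linear_combination h
    have habs : (a + (birth + death) * (n + 1)) * |x (n + 1)|
        ≤ birth * n * |x n| + death * (n + 2) * |x (n + 2)| := by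
      rw [← abs_of_nonneg (show 0 ≤ a + (birth + death) * ((n : ℝ) + 1) by positivity), ← abs_mul,
        hres]
      refine (abs_add_le _ _).trans_eq ?_
      rw [abs_mul (birth * n), abs_mul (death * (n + 2 : ℝ)),
        abs_of_nonneg (show 0 ≤ birth * (n : ℝ) by positivity),
        abs_of_nonneg (show 0 ≤ death * ((n : ℝ) + 2) by positivity)]
    rw [Finset.sum_range_succ]
    push_cast
    linarith

-- A nonzero entry forces `|x (n + 1)| ≥ c / (n + 1)` eventually, so that `x` is not summable.
theorem eq_zero_of_summable_of_resolvent (hb : 0 ≤ birth) (hd : 0 ≤ death) (ha : 0 < a)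
    (hs : Summable fun k => x (k + 1))
    (hx : ∀ k, 1 ≤ k → a * x k = kolmogorovForward birth death x k) {k : ℕ} (hk : 1 ≤ k) :
    x k = 0 := by
  by_contra hne
  have hpos : 0 < a * |x k| := mul_pos ha (abs_pos.2 hne)
  have hlower : ∀ n ≥ k, ‖a * |x k| * (1 / ((n : ℝ) + 1))‖ ≤ death * |x (n + 1)| := by
    intro n hn
    have hmem : |x k| ≤ ∑ j ∈ Finset.range n, |x (j + 1)| := by
      have h := Finset.single_le_sum (f := fun j => |x (j + 1)|) (fun j _ => abs_nonneg _)
        (Finset.mem_range.2 (show k - 1 < n by lia))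
      rwa [Nat.sub_add_cancel hk] at h
    have hsum := sum_abs_le_of_resolvent hb hd ha.le hx n
    have hbirth : 0 ≤ birth * n * |x n| := by positivity
    rw [Real.norm_of_nonneg (by positivity), mul_one_div, div_le_iff₀ (by positivity)]
    linarith [mul_le_mul_of_nonneg_left hmem ha.le]
  have hharmonic : Summable fun n : ℕ => a * |x k| * (1 / ((n : ℝ) + 1)) :=
    .of_norm_bounded_eventually_nat (hs.abs.mul_left death)
      (eventually_atTop.2 ⟨k, hlower⟩)
  rw [summable_mul_left_iff hpos.ne'] at hharmonic
  exact Real.not_summable_one_div_natCast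
    ((summable_nat_add_iff 1).1 (by simpa using hharmonic))

end Resolvent

namespace SolvesBirthDeathSystem

variable {ν birth death t u : ℝ} {i k : ℕ} {p p' : ℕ → ℝ → ℝ}

theorem hasCaputoDeriv (hp : SolvesBirthDeathSystem ν birth death i p) (hk : 1 ≤ k) :
    HasCaputoDeriv ν (p k) fun t => kolmogorovForward birth death (fun j => p j t) k :=
  hp.equation k hk

theorem abs_le_one (hp : SolvesBirthDeathSystem ν birth death i p) (k : ℕ) (ht : 0 ≤ t) :
    |p k t| ≤ 1 := by
  rw [abs_of_nonneg (hp.nonneg k t ht)]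
  exact le_hasSum (hp.hasSum_one t ht) k fun j _ => hp.nonneg j t ht

theorem continuousOn (hp : SolvesBirthDeathSystem ν birth death i p) (hk : 1 ≤ k) :
    ContinuousOn (p k) (Ici 0) :=
  (hp.equation k hk).contDiffOn.continuousOn

theorem laplaceIntegrable (hp : SolvesBirthDeathSystem ν birth death i p) (hu : 0 < u)
    (hk : 1 ≤ k) : LaplaceIntegrable (p k) u :=
  .of_continuousOn hu (hp.continuousOn hk) fun _ => hp.abs_le_one k

theorem laplace_eq (hp : SolvesBirthDeathSystem ν birth death i p) (hν0 : 0 < ν) (hν1 : ν ≤ 1)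
    (hk : 1 ≤ k) (hu : 0 < u) :
    u ^ ν * laplace (p k) u = u ^ ν * (p k 0 / u)
      + kolmogorovForward birth death (fun j => laplace (p j) u) k := by
  have hint := fun j => hp.laplaceIntegrable (k := j) hu
  have hforward : LaplaceIntegrable
      (fun t => kolmogorovForward birth death (fun j => p j t) k) u := by
    simp only [LaplaceIntegrable, mul_kolmogorovForward]
    exact integrable_kolmogorovForward hint hk
  rw [laplace_eq_of_eq_const_add_fracInt hν0 hu hforward fun t ht =>
      (hp.hasCaputoDeriv hk).eq_add_fracInt_of_le_one hν0 hν1 (le_of_lt ht),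
    mul_add, Real.rpow_neg hu.le, mul_inv_cancel_left₀ (Real.rpow_pos_of_pos hu ν).ne', laplace]
  simp only [mul_kolmogorovForward]
  rw [integral_kolmogorovForward hint hk]
  rfl

theorem sum_succ_le_one (hp : SolvesBirthDeathSystem ν birth death i p) (ht : 0 ≤ t) (n : ℕ) :
    ∑ k ∈ Finset.range n, p (k + 1) t ≤ 1 := by
  have hsum : ∑ k ∈ Finset.range (n + 1), p k t ≤ 1 :=
    sum_le_hasSum _ (fun j _ => hp.nonneg j t ht) (hp.hasSum_one t ht)
  rw [Finset.sum_range_succ'] at hsum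
  linarith [hp.nonneg 0 t ht]

theorem summable_laplace (hp : SolvesBirthDeathSystem ν birth death i p) (hu : 0 < u) :
    Summable fun k => laplace (p (k + 1)) u := by
  refine summable_of_sum_range_le (c := laplace (fun _ => 1) u)
    (fun k => setIntegral_nonneg measurableSet_Ioi fun t ht =>
      mul_nonneg (Real.exp_pos _).le (hp.nonneg _ t (le_of_lt ht))) fun n => ?_
  have hint : ∀ k ∈ Finset.range n, Integrable (fun t => Real.exp (-(u * t)) * p (k + 1) t)
      (volume.restrict (Ioi 0)) := fun k _ => hp.laplaceIntegrable hu (by lia)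
  simp only [laplace]
  rw [← integral_finsetSum _ hint]
  refine setIntegral_mono_on (integrable_finsetSum _ hint) (LaplaceIntegrable.const hu 1)
    measurableSet_Ioi fun t ht => ?_
  rw [← Finset.mul_sum]
  exact mul_le_mul_of_nonneg_left (hp.sum_succ_le_one (le_of_lt ht) n) (Real.exp_pos _).le

theorem eq_of_one_le (hp : SolvesBirthDeathSystem ν birth death i p)
    (hp' : SolvesBirthDeathSystem ν birth death i p') (hν0 : 0 < ν) (hν1 : ν ≤ 1)
    (hb : 0 ≤ birth) (hd : 0 ≤ death) (hk : 1 ≤ k) : EqOn (p k) (p' k) (Ici 0) := by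
  refine eqOn_of_laplace_eq (hp.continuousOn hk) (hp'.continuousOn hk)
    (fun _ => hp.abs_le_one k) (fun _ => hp'.abs_le_one k) fun u hu => sub_eq_zero.1 ?_
  refine eq_zero_of_summable_of_resolvent (x := fun k => laplace (p k) u - laplace (p' k) u)
    hb hd (Real.rpow_pos_of_pos hu ν) ((hp.summable_laplace hu).sub (hp'.summable_laplace hu))
    (fun k hk => ?_) hk
  rw [mul_sub, hp.laplace_eq hν0 hν1 hk hu, hp'.laplace_eq hν0 hν1 hk hu, hp.initial, hp'.initial,
    kolmogorovForward_sub, add_sub_add_left_eq_sub]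

theorem unique (hp : SolvesBirthDeathSystem ν birth death i p)
    (hp' : SolvesBirthDeathSystem ν birth death i p') (hν0 : 0 < ν) (hν1 : ν ≤ 1)
    (hb : 0 ≤ birth) (hd : 0 ≤ death) (k : ℕ) : EqOn (p k) (p' k) (Ici 0) := by
  intro t ht
  have hsucc : ∀ n, p (n + 1) t = p' (n + 1) t := fun n =>
    hp.eq_of_one_le hp' hν0 hν1 hb hd (by lia) ht
  cases k with
  | zero =>
    have h := (hasSum_nat_add_iff' 1).2 (hp.hasSum_one t ht)
    have h' := (hasSum_nat_add_iff' 1).2 (hp'.hasSum_one t ht)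
    simp only [hsucc, Finset.sum_range_one] at h h'
    exact sub_right_inj.1 (h.unique h')
  | succ n => exact hsucc n

end SolvesBirthDeathSystem

theorem HasCaputoDeriv.congr {α : ℝ} {f g D E : ℝ → ℝ} (h : HasCaputoDeriv α f D)
    (hfg : EqOn g f (Ici 0)) (hDE : EqOn E D (Ioi 0)) : HasCaputoDeriv α g E := by
  have hiter := iteratedDerivWithin_congr hfg (n := ⌈α⌉₊ - 1)
  have hnhds : ∀ {t : ℝ}, 0 < t → iteratedDerivWithin (⌈α⌉₊ - 1) g (Ici 0)
      =ᶠ[𝓝 t] iteratedDerivWithin (⌈α⌉₊ - 1) f (Ici 0) := fun ht => by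
    filter_upwards [Ioi_mem_nhds ht] with s hs using hiter (Ioi_subset_Ici_self hs)
  have hintegrand : ∀ t, EqOn
      (fun s => deriv (iteratedDerivWithin (⌈α⌉₊ - 1) f (Ici 0)) s * (t - s) ^ (⌈α⌉₊ - α - 1))
      (fun s => deriv (iteratedDerivWithin (⌈α⌉₊ - 1) g (Ici 0)) s * (t - s) ^ (⌈α⌉₊ - α - 1))
      (Ioo 0 t) := fun t s hs => by
    simp only [(hnhds hs.1).deriv_eq]
  refine ⟨h.contDiffOn.congr hfg, fun t ht => ?_, fun hα t ht => ?_, fun hα t ht => ?_,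
    fun hα t ht => ?_⟩
  · refine absolutelyContinuousOnInterval_congr (h.absolutelyContinuous t ht) fun s hs => ?_
    rw [uIcc_of_le ht.le] at hs
    exact (hiter hs.1).symm
  · rw [hDE ht]
    exact (h.eq_of_integer hα t ht).congr_of_eventuallyEq (hnhds ht)
  · refine (h.integrable_of_noninteger hα t ht).congr_uIoo ?_
    rw [uIoo_of_le ht.le]
    exact hintegrand t
  · rw [hDE ht, h.eq_of_noninteger hα t ht,
      intervalIntegral.integral_congr_Ioo_of_le ht.le (hintegrand t)]

namespace SolvesBirthDeathSystem

variable {ν birth death : ℝ} {i k : ℕ} {p p' : ℕ → ℝ → ℝ}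

theorem congr (hp : SolvesBirthDeathSystem ν birth death i p)
    (h : ∀ k, EqOn (p' k) (p k) (Ici 0)) : SolvesBirthDeathSystem ν birth death i p' where
  nonneg k t ht := (hp.nonneg k t ht).trans_eq (h k ht).symm
  hasSum_one t ht := by simpa only [h _ ht] using hp.hasSum_one t ht
  initial k := (h k self_mem_Ici).trans (hp.initial k)
  equation k hk := (hp.equation k hk).congr (h k) fun t ht => by
    simp only [h _ (Ioi_subset_Ici_self ht)]

theorem tendsto_one_sub_sum_succ (hp : SolvesBirthDeathSystem ν birth death i p) {t : ℝ}
    (ht : 0 ≤ t) :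
    Tendsto (fun n => 1 - ∑ k ∈ Finset.range n, p (k + 1) t) atTop (𝓝 (p 0 t)) := by
  have hsucc := ((hasSum_nat_add_iff' 1).2 (hp.hasSum_one t ht)).tendsto_sum_nat.const_sub 1
  simpa only [Finset.sum_range_one, sub_sub_cancel] using hsucc

theorem measurable_comp_abs (hp : SolvesBirthDeathSystem ν birth death i p) (k : ℕ) :
    Measurable fun x => p k |x| := by
  have hsucc : ∀ j, Measurable fun x => p (j + 1) |x| := fun j =>
    ((hp.continuousOn (by lia)).comp_continuous continuous_abs fun x => abs_nonneg x).measurable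
  cases k with
  | zero =>
    exact measurable_of_tendsto_metrizable
      (fun n => measurable_const.sub (Finset.measurable_fun_sum _ fun j _ => hsucc j))
      (tendsto_pi_nhds.2 fun x => hp.tendsto_one_sub_sum_succ (abs_nonneg x))
  | succ j => exact hsucc j

theorem integrable_comp_abs (hp : SolvesBirthDeathSystem ν birth death i p) (m : Measure ℝ)
    [IsFiniteMeasure m] (k : ℕ) : Integrable (fun x => p k |x|) m :=
  .of_bound (hp.measurable_comp_abs k).aestronglyMeasurable 1
    (.of_forall fun x => hp.abs_le_one k (abs_nonneg x))

theorem hasSum_integral_comp_abs (hp : SolvesBirthDeathSystem ν birth death i p) (m : Measure ℝ)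
    [IsProbabilityMeasure m] : HasSum (fun k => ∫ x, p k |x| ∂m) 1 := by
  have hsum : ∀ x : ℝ, HasSum (fun k => p k |x|) 1 := fun x => hp.hasSum_one _ (abs_nonneg x)
  have h := hasSum_integral_of_dominated_convergence (μ := m) (fun k x => p k |x|)
    (fun k => (hp.measurable_comp_abs k).aestronglyMeasurable)
    (fun k => .of_forall fun x =>
      (Real.norm_of_nonneg (hp.nonneg k _ (abs_nonneg x))).le)
    (.of_forall fun x => (hsum x).summable)
    (by simpa only [(hsum _).tsum_eq] using integrable_const 1)
    (.of_forall hsum)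
  rwa [integral_const, probReal_univ, one_smul] at h

theorem hasDerivAt (hp : SolvesBirthDeathSystem 1 birth death i p) (hk : 1 ≤ k) {t : ℝ}
    (ht : 0 < t) :
    HasDerivAt (p k) (kolmogorovForward birth death (fun j => p j t) k) t := by
  simpa only [Nat.ceil_one, Nat.sub_self, iteratedDerivWithin_zero] using
    (hp.hasCaputoDeriv hk).eq_of_integer (by simp) t ht

theorem integral_comp_abs (hp : SolvesBirthDeathSystem 1 birth death i p) {q : ℝ → Measure ℝ}
    (hq : IsFundamentalSolution (2 * ν) q) (hν0 : 0 < ν) (hν1 : ν ≤ 1) :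
    SolvesBirthDeathSystem ν birth death i fun k t => ∫ x, p k |x| ∂(q t) where
  nonneg k t _ := integral_nonneg fun x => hp.nonneg k _ (abs_nonneg x)
  hasSum_one t ht :=
    have := hq.isProbabilityMeasure t ht
    hp.hasSum_integral_comp_abs (q t)
  initial k := by rw [hq.integral_zero, abs_zero, hp.initial]
  equation k hk := by
    refine (hq.hasCaputoDeriv_integral_comp_abs hν0 hν1 (hp.continuousOn hk)
      (continuousOn_kolmogorovForward (fun _ => hp.continuousOn) hk)
      (fun _ => hp.hasDerivAt hk) (fun _ => hp.abs_le_one k)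
      (fun s hs => abs_kolmogorovForward_le (fun j => hp.abs_le_one j hs) k)).congr
      (fun _ _ => rfl) fun t ht => ?_
    have := hq.isProbabilityMeasure t (le_of_lt ht)
    exact (integral_kolmogorovForward (fun j _ => hp.integrable_comp_abs (q t) j) hk).symm

end SolvesBirthDeathSystem

theorem measureReal_prod_eq_integral {α β : Type*} [MeasurableSpace α] [MeasurableSpace β]
    {m : Measure α} {n : Measure β} [IsFiniteMeasure n] {B : Set (α × β)}
    (hB : MeasurableSet B) : (m.prod n).real B = ∫ a, n.real (Prod.mk a ⁻¹' B) ∂m := by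
  simp only [measureReal_def]
  rw [Measure.prod_apply hB, integral_toReal (measurable_measure_prodMk_left hB).aemeasurable
    (.of_forall fun a => measure_lt_top _ _)]

/-- The right end of the cell of the grid of mesh `1 / (n + 1)` that contains `s`: an approximation
of `s` from the right with countably many values. -/
def upperGrid (n : ℕ) (s : ℝ≥0) : ℝ≥0 :=
  ((⌊((n : ℝ≥0) + 1) * s⌋₊ : ℝ≥0) + 1) / ((n : ℝ≥0) + 1)

theorem le_upperGrid (n : ℕ) (s : ℝ≥0) : s ≤ upperGrid n s := by
  rw [upperGrid, le_div_iff₀ (by positivity), mul_comm]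
  exact (Nat.lt_floor_add_one _).le

theorem upperGrid_le (n : ℕ) (s : ℝ≥0) : upperGrid n s ≤ s + 1 / ((n : ℝ≥0) + 1) := by
  rw [upperGrid, add_div]
  gcongr
  rw [div_le_iff₀ (by positivity), mul_comm s]
  exact Nat.floor_le zero_le

theorem tendsto_upperGrid (s : ℝ≥0) : Tendsto (upperGrid · s) atTop (𝓝[≥] s) := by
  refine tendsto_nhdsWithin_iff.2 ⟨?_, .of_forall fun n => le_upperGrid n s⟩
  refine tendsto_of_tendsto_of_tendsto_of_le_of_le tendsto_const_nhds ?_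
    (fun n => le_upperGrid n s) (fun n => upperGrid_le n s)
  simpa only [add_zero] using
    (tendsto_one_div_add_atTop_nhds_zero_nat (𝕜 := ℝ≥0)).const_add s

section RightContinuous

variable {Ω E : Type*} [MeasurableSpace Ω] [MeasurableSpace E]
  {X : ℝ≥0 → Ω → E}

theorem measurable_comp_upperGrid (hX : ∀ t, Measurable (X t)) (n : ℕ) :
    Measurable fun p : ℝ≥0 × Ω => X (upperGrid n p.1) p.2 := by
  have hcell : Measurable fun p : ℕ × Ω => X (((p.1 : ℝ≥0) + 1) / ((n : ℝ≥0) + 1)) p.2 :=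
    measurable_from_prod_countable_right fun j => hX (((j : ℝ≥0) + 1) / ((n : ℝ≥0) + 1))
  exact hcell.comp (f := fun p : ℝ≥0 × Ω => (⌊((n : ℝ≥0) + 1) * p.1⌋₊, p.2)) (by fun_prop)

variable [TopologicalSpace E] [TopologicalSpace.PseudoMetrizableSpace E] [BorelSpace E]

theorem measurable_uncurry_of_right_continuous (hX : ∀ t, Measurable (X t))
    (hrc : ∀ ω s, ContinuousWithinAt (fun r => X r ω) (Ici s) s) :
    Measurable fun p : ℝ≥0 × Ω => X p.1 p.2 :=
  measurable_of_tendsto_metrizable (measurable_comp_upperGrid hX)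
    (tendsto_pi_nhds.2 fun p => (hrc p.2 p.1).tendsto.comp (tendsto_upperGrid p.1))

theorem measurable_measureReal_of_right_continuous (P : Measure Ω) [SFinite P]
    (hX : ∀ t, Measurable (X t)) (hrc : ∀ ω s, ContinuousWithinAt (fun r => X r ω) (Ici s) s)
    {A : Set E} (hA : MeasurableSet A) : Measurable fun s => P.real {ω | X s ω ∈ A} :=
  (measurable_measure_prodMk_left
    (measurable_uncurry_of_right_continuous hX hrc hA)).ennreal_toReal

/-- The space of right-continuous paths in `E`, a subspace of the product `ℝ≥0 → E`. Unlike on the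
whole product, evaluation is jointly measurable in time and path. -/
abbrev RightContinuousPath (E : Type*) [TopologicalSpace E] : Type _ :=
  {w : ℝ≥0 → E // ∀ s, ContinuousWithinAt w (Ici s) s}

theorem RightContinuousPath.measurable_eval :
    Measurable fun p : ℝ≥0 × RightContinuousPath E => p.2.1 p.1 :=
  measurable_uncurry_of_right_continuous (X := fun s (w : RightContinuousPath E) => w.1 s)
    (fun s => (measurable_pi_apply s).comp measurable_subtype_coe) fun w => w.2

theorem measureReal_comp_eq_integral {P : Measure Ω} [IsProbabilityMeasure P] {S : Ω → ℝ≥0}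
    (hX : ∀ t, Measurable (X t)) (hrc : ∀ ω s, ContinuousWithinAt (fun r => X r ω) (Ici s) s)
    (hS : Measurable S) (hindep : IndepFun S (fun ω s => X s ω) P) {A : Set E}
    (hA : MeasurableSet A) :
    P.real {ω | X (S ω) ω ∈ A} = ∫ s, P.real {ω | X s ω ∈ A} ∂(P.map S) := by
  let Y : Ω → RightContinuousPath E := fun ω => ⟨fun s => X s ω, hrc ω⟩
  have hY : Measurable Y := (measurable_pi_lambda _ hX).subtype_mk
  have hindepY : IndepFun S Y P := by
    rw [IndepFun_iff_Indep] at hindep ⊢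
    convert hindep using 1
    exact MeasurableSpace.comap_comp
  have hevent := RightContinuousPath.measurable_eval hA
  calc P.real {ω | X (S ω) ω ∈ A}
      = (P.map fun ω => (S ω, Y ω)).real ((fun p => p.2.1 p.1) ⁻¹' A) :=
        (map_measureReal_apply (hS.prodMk hY) hevent).symm
    _ = ∫ s, (P.map Y).real (Prod.mk s ⁻¹' ((fun p => p.2.1 p.1) ⁻¹' A)) ∂(P.map S) := by
        rw [hindepY.map_prod_eq_prod_map_map hS.aemeasurable hY.aemeasurable,
          measureReal_prod_eq_integral hevent]
    _ = ∫ s, P.real {ω | X s ω ∈ A} ∂(P.map S) :=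
        integral_congr_ae (.of_forall fun s =>
          map_measureReal_apply hY (measurable_prodMk_left hevent))

end RightContinuous

theorem continuous_nnabs : Continuous Real.nnabs :=
  NNReal.isEmbedding_coe.continuous_iff.2 continuous_abs

theorem integral_fold {m : Measure ℝ} {g : ℝ≥0 → ℝ} (hg : Measurable g) :
    ∫ s, g s ∂(fold m) = ∫ x, g (Real.nnabs x) ∂m :=
  integral_map continuous_nnabs.aemeasurable hg.aestronglyMeasurable

section TimeChange

variable {Ω : Type*} [MeasurableSpace Ω] {ν birth death : ℝ} {P : Measure Ω}
  [IsProbabilityMeasure P] {N : ℝ≥0 → Ω → ℕ}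

theorem stateProb_comp_eq_integral {T : ℝ≥0 → Ω → ℝ≥0} {q : ℝ → Measure ℝ}
    (hN : ∀ t, Measurable (N t)) (hrc : ∀ ω s, ContinuousWithinAt (fun r => N r ω) (Ici s) s)
    (hTmeas : ∀ t, Measurable (T t)) (hTlaw : ∀ t, P.map (T t) = fold (q t))
    (hindep : ∀ t, IndepFun (T t) (fun ω s => N s ω) P) (k : ℕ) {t : ℝ} (ht : 0 ≤ t) :
    stateProb P (fun t ω => N (T t ω) ω) k t = ∫ x, stateProb P N k |x| ∂(q t) := by
  have h := measureReal_comp_eq_integral hN hrc (hTmeas t.toNNReal) (hindep t.toNNReal)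
    (measurableSet_singleton k)
  rw [hTlaw, Real.coe_toNNReal t ht, integral_fold
    (measurable_measureReal_of_right_continuous P hN hrc (measurableSet_singleton k))] at h
  simp only [stateProb, Real.toNNReal_abs]
  exact h

theorem IsClassicalLinearBirthDeath.isFractionalLinearBirthDeath
    (hN : IsClassicalLinearBirthDeath birth death P N) :
    IsFractionalLinearBirthDeath 1 birth death P N := by
  obtain ⟨p, hp, hmarkov⟩ := hN.markov
  refine ⟨hN.measurable, (hp 1).congr fun k t ht => ?_⟩
  have h := hmarkov 0 t.toNNReal 1 k univ MeasurableSet.univ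
  have hstart : P.real {ω | N 0 ω = 1} = 1 := by
    rw [measureReal_congr (eventuallyEq_univ.2 hN.initial), probReal_univ]
  have hstate : P.real ({ω | N 0 ω = 1} ∩ {ω | N t.toNNReal ω = k}) = stateProb P N k t :=
    measureReal_congr (inter_ae_eq_right_of_ae_eq_univ (eventuallyEq_univ.2 hN.initial))
  rwa [univ_inter, zero_add, hstart, hstate, one_mul, Real.coe_toNNReal t ht] at h

theorem IsFractionalLinearBirthDeath.identDistrib {Ω' : Type*} [MeasurableSpace Ω']
    {P' : Measure Ω'} [IsProbabilityMeasure P'] {N' : ℝ≥0 → Ω' → ℕ}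
    (hN : IsFractionalLinearBirthDeath ν birth death P N)
    (hN' : IsFractionalLinearBirthDeath ν birth death P' N') (hν0 : 0 < ν) (hν1 : ν ≤ 1)
    (hb : 0 ≤ birth) (hd : 0 ≤ death) (t : ℝ≥0) : IdentDistrib (N t) (N' t) P P' where
  aemeasurable_fst := (hN.measurable t).aemeasurable
  aemeasurable_snd := (hN'.measurable t).aemeasurable
  map_eq := by
    refine Measure.ext_of_singleton fun k => ?_
    rw [Measure.map_apply (hN.measurable t) (measurableSet_singleton k),
      Measure.map_apply (hN'.measurable t) (measurableSet_singleton k)]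
    have h := hN.stateProb_solves.unique hN'.stateProb_solves hν0 hν1 hb hd k t.coe_nonneg
    rw [stateProb, stateProb, Real.toNNReal_coe] at h
    exact (measureReal_eq_measureReal_iff (measure_ne_top _ _) (measure_ne_top _ _)).1 h

end TimeChange

end FracBD

end

theorem theorem2p1_general {ν birth death : ℝ} (hν0 : 0 < ν) (hν1 : ν ≤ 1)
    (hbirth : 0 ≤ birth) (hdeath : 0 ≤ death)
    {q : ℝ → Measure ℝ} (hq : FracBD.IsFundamentalSolution (2 * ν) q)
    {Ω : Type*} [MeasurableSpace Ω] {P : Measure Ω} [IsProbabilityMeasure P]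
    {N : ℝ≥0 → Ω → ℕ} (hN : FracBD.IsFractionalLinearBirthDeath 1 birth death P N)
    (hrc : ∀ ω s, ContinuousWithinAt (fun r => N r ω) (Ici s) s)
    {T : ℝ≥0 → Ω → ℝ≥0} (hTmeas : ∀ t, Measurable (T t))
    (hTlaw : ∀ t, P.map (T t) = FracBD.fold (q t))
    (hindep : ∀ t, IndepFun (T t) (fun ω s => N s ω) P) :
    FracBD.IsFractionalLinearBirthDeath ν birth death P (fun t ω => N (T t ω) ω) ∧
    ∀ {Ω' : Type*} [MeasurableSpace Ω'] (P' : Measure Ω') [IsProbabilityMeasure P']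
      (Nν : ℝ≥0 → Ω' → ℕ), FracBD.IsFractionalLinearBirthDeath ν birth death P' Nν →
      ∀ t, IdentDistrib (Nν t) (fun ω => N (T t ω) ω) P' P := by
  have hmeas : ∀ t, Measurable fun ω => N (T t ω) ω := fun t =>
    (FracBD.measurable_uncurry_of_right_continuous hN.measurable hrc).comp
      ((hTmeas t).prodMk measurable_id)
  have hsolves := (hN.stateProb_solves.integral_comp_abs hq hν0 hν1).congr fun k t ht =>
    FracBD.stateProb_comp_eq_integral hN.measurable hrc hTmeas hTlaw hindep k ht
  have hmain : FracBD.IsFractionalLinearBirthDeath ν birth death P fun t ω => N (T t ω) ω :=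
    ⟨hmeas, hsolves⟩
  exact ⟨hmain, fun P' _ Nν hNν => hNν.identDistrib hmain hν0 hν1 hbirth hdeath⟩

theorem theorem2p1 (ν birth death : ℝ) (hν0 : 0 < ν) (hν1 : ν ≤ 1)
    (hbirth : 0 < birth) (hdeath : 0 < death)
    (q : ℝ → Measure ℝ) (hq : FracBD.IsFundamentalSolution (2 * ν) q)
    {Ω : Type*} [MeasurableSpace Ω] (P : Measure Ω) [IsProbabilityMeasure P]
    (N : ℝ≥0 → Ω → ℕ) (hN : FracBD.IsClassicalLinearBirthDeath birth death P N)
    (T : ℝ≥0 → Ω → ℝ≥0) (hTmeas : ∀ t, Measurable (T t))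
    (hTlaw : ∀ t, P.map (T t) = FracBD.fold (q t))
    (hindep : ∀ t, IndepFun (T t) (fun ω s => N s ω) P) :
    FracBD.IsFractionalLinearBirthDeath ν birth death P (fun t ω => N (T t ω) ω) ∧
    ∀ {Ω' : Type*} [MeasurableSpace Ω'] (P' : Measure Ω') [IsProbabilityMeasure P']
      (Nν : ℝ≥0 → Ω' → ℕ), FracBD.IsFractionalLinearBirthDeath ν birth death P' Nν →
      ∀ t, IdentDistrib (Nν t) (fun ω => N (T t ω) ω) P' P := by
  exact theorem2p1_general hν0 hν1 hbirth.le hdeath.le hq hN.isFractionalLinearBirthDeath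
    hN.right_continuous hTmeas hTlaw hindep
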